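/- All vector spaces and algebras are over $\mathbb C$, and unadorned modules are right modules. A \emph{quantum polynomial algebra} is a connected $\mathbb N$-graded algebra $A=\bigoplus_{i\ge 0}A_i$ ($A_0=\mathbb C$, all $A_i$ finite dimensional) which is a two-sided noetherian domain, is Artin--Schelter regular (that is, $\operatorname{id}{}_AA=\operatorname{id}A_A=d<\infty$; $\underline{\mathrm{Ext}}^i_A(\mathbb C_A,A_A)=0$ for $i\ne d$ and $\underline{\mathrm{Ext}}^d_A(\mathbb C_A,A_A)\cong{}_A\mathbb C(l)$ for some $l\in\mathbb Z$; the left version of this condition holds; and $A$ has finite global dimension), is Koszul (the trivial module $\mathbb C_A$ has a graded free resolution $\cdots\to P^1\to P^0\to\mathbb C\to 0$ with $P^i$ generated in degree $i$ for all $i$), and has Hilbert series $\sum_i \dim(A_i)t^i=1/(1-t)^m$ for some $m>0$. Let $A$ be a quantum polynomial algebra of global dimension $n$. Put $V=A_1$, let $R\subseteq V\otimes V$ be the kernel of the multiplication $V\otimes V\to A_2$, so that $A\cong T(V)/(R)$, let $R^\perp\subseteq V^*\otimes V^*$ be the orthogonal complement of $R$, and let $A^!=T(V^*)/(R^\perp)$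 be the quadratic dual. Let $f\in A_2$ be a central regular element (a non-zero-divisor on both sides), let $r_0\in V\otimes V$ be any preimage of $f$, and define $\theta_f\colon R^\perp\to\mathbb C$ by $\theta_f(\alpha)=\alpha(r_0)$, which does not depend on the choice of $r_0$. The \emph{Clifford deformation} of $A^!$ associated to $\theta_f$ is $$C_{A^!}(\theta_f)=T(V^*)/\bigl(\alpha-\theta_f(\alpha)\,:\,\alpha\in R^\perp\bigr),$$ with the $\mathbb Z_2$-grading induced by the parity of tensor degree. One says that $A/(f)$ is a \emph{simple graded isolated singularity} if $C_{A^!}(\theta_f)$ is a simple $\mathbb Z_2$-graded algebra; it is then said to be of \emph{$0$-type} (respectively of \emph{$1$-type}) if $C_{A^!}(\theta_f)$ is isomorphic, as a $\mathbb Z_2$-graded algebra, to a matrix algebra, possibly with degree shifts, over $\mathbb C$ concentrated in degree $0$ (respectively over the group algebra $\mathbb C\mathbb G$ of the group $\mathbb G=\{1,\sigma\}$ of order $2$, with $|1|=0$ and $|\sigma|=1$). Then $\dim_{\mathbb C} C_{A^!}(\theta_f)=2^n$. Moreover: (i) if $A/(f)$ is a simple graded isolated singularity of $0$-type, then $n$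 is even; (ii) if $A/(f)$ is a simple graded isolated singularity of $1$-type, then $n$ is odd. -/

import Mathlib

open scoped TensorProduct
open CategoryTheory

universe u

noncomputable section

namespace QuadricHypersurface

/-! ### Global dimension -/

/-- The (left) global dimension of a ring `R`: the supremum of the projective dimensions of all
left `R`-modules. Right modules over `A` are left modules over `Aᵐᵒᵖ`, so the right global
dimension of `A` is `globalDimension Aᵐᵒᵖ`. -/
def globalDimension (R : Type u) [Ring R] : WithBot ℕ∞ :=
  ⨆ M : ModuleCat.{u} R, projectiveDimension M

/-! ### Graded resolutions of the trivial module and graded Ext -/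

section Graded

variable {R : Type u} [Ring R] [Algebra ℂ R]

/-- The grading `i ↦ (R_i)ᵒᵖ` of the opposite algebra. -/
def opGrading (𝓡 : ℕ → Submodule ℂ R) : ℕ → Submodule ℂ Rᵐᵒᵖ :=
  fun i => (𝓡 i).map (MulOpposite.opLinearEquiv ℂ).toLinearMap

/-- An `ℕ`-grading viewed as a `ℤ`-grading, by zero in negative degrees. -/
def intGrading (𝓡 : ℕ → Submodule ℂ R) : ℤ → Submodule ℂ R
  | Int.ofNat k => 𝓡 k
  | Int.negSucc _ => ⊥

/-- The augmentation ideal `R_{≥ 1}`, as a left ideal. -/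
def augIdeal (𝓡 : ℕ → Submodule ℂ R) : Ideal R :=
  Ideal.span {x | ∃ i, 0 < i ∧ x ∈ 𝓡 i}

/-- The trivial left module `R / R_{≥ 1}`, concentrated in degree `0`. -/
abbrev TrivialModule (𝓡 : ℕ → Submodule ℂ R) : Type u := R ⧸ augIdeal 𝓡

/-- A resolution `⋯ ⟶ P¹ ⟶ P⁰ ⟶ k ⟶ 0` of the trivial left module by graded free left modules
and degree preserving maps. The module `Pⁿ` is free on `ι n`, the basis element indexed by `j`
being homogeneous of degree `deg n j`. -/
structure GradedFreeResolution (𝓡 : ℕ → Submodule ℂ R) where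
  /-- the index set of a homogeneous basis of `Pⁿ` -/
  ι : ℕ → Type u
  /-- the degrees of the basis elements -/
  deg : ∀ n, ι n → ℤ
  /-- the differentials -/
  d : ∀ n, (ι (n + 1) →₀ R) →ₗ[R] (ι n →₀ R)
  /-- the augmentation -/
  ε : (ι 0 →₀ R) →ₗ[R] TrivialModule 𝓡
  d_mem : ∀ n j i, d n (Finsupp.single j 1) i ∈ intGrading 𝓡 (deg (n + 1) j - deg n i)
  ε_eq_zero : ∀ j, deg 0 j ≠ 0 → ε (Finsupp.single j 1) = 0
  ε_surjective : Function.Surjective ε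
  exact_zero : Function.Exact (d 0) ε
  exact_succ : ∀ n, Function.Exact (d (n + 1)) (d n)

namespace GradedFreeResolution

variable {𝓡 : ℕ → Submodule ℂ R} (P : GradedFreeResolution 𝓡)

/-- `P` is linear if `Pⁿ` is generated in degree `n` for all `n`. -/
def IsLinear : Prop := ∀ n j, P.deg n j = n

/-- The homomorphism `φ` is a degree preserving map `Pⁿ ⟶ R(i)`, where `R(i)_m = R_{i + m}`. -/
def IsHomogeneousHom (n : ℕ) (i : ℤ) (φ : (P.ι n →₀ R) →ₗ[R] R) : Prop :=
  ∀ j, φ (Finsupp.single j 1) ∈ intGrading 𝓡 (P.deg n j + i)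

/-- The graded dual `⨁ᵢ Hom_{Gr R}(Pⁿ, R(i))`, a right `R`-module (a left `Rᵐᵒᵖ`-module)
through the right multiplication of `R` on itself. -/
def cochains (n : ℕ) : Submodule Rᵐᵒᵖ ((P.ι n →₀ R) →ₗ[R] R) :=
  Submodule.span Rᵐᵒᵖ {φ | ∃ i : ℤ, P.IsHomogeneousHom n i φ}

/-- Composition with the differential, `Hom(Pⁿ, R) ⟶ Hom(Pⁿ⁺¹, R)`. -/
def coboundaryMap (n : ℕ) :
    ((P.ι n →₀ R) →ₗ[R] R) →ₗ[Rᵐᵒᵖ] ((P.ι (n + 1) →₀ R) →ₗ[R] R) where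
  toFun φ := φ.comp (P.d n)
  map_add' _ _ := rfl
  map_smul' _ _ := rfl

/-- The cocycles of the graded dual complex. -/
def cocycles (n : ℕ) : Submodule Rᵐᵒᵖ ((P.ι n →₀ R) →ₗ[R] R) :=
  P.cochains n ⊓ LinearMap.ker (P.coboundaryMap n)

/-- The coboundaries of the graded dual complex. -/
def coboundaries : ∀ n : ℕ, Submodule Rᵐᵒᵖ ((P.ι n →₀ R) →ₗ[R] R)
  | 0 => ⊥
  | n + 1 => (P.cochains n).map (P.coboundaryMap n)

/-- The graded Ext module `Extⁿ(k, R)`, computed with the resolution `P`: the space of cocycles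
modulo coboundaries, as a submodule of `Hom(Pⁿ, R)` modulo coboundaries. -/
def gradedExt (n : ℕ) : Submodule Rᵐᵒᵖ (((P.ι n →₀ R) →ₗ[R] R) ⧸ P.coboundaries n) :=
  (P.cocycles n).map (P.coboundaries n).mkQ

/-- The class of a cocycle. -/
def extClass {n : ℕ} (φ : (P.ι n →₀ R) →ₗ[R] R) (hφ : φ ∈ P.cocycles n) : P.gradedExt n :=
  ⟨(P.coboundaries n).mkQ φ, Submodule.mem_map_of_mem hφ⟩

/-- `Extⁿ(k, R) ≅ k(l)` as graded right `R`-modules. As `k(l)` is concentrated in degree `-l`,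
an isomorphism is graded when it kills the classes of homogeneous cocycles of other degrees. -/
def ExtIsoTrivialShift (n : ℕ) (l : ℤ) : Prop :=
  ∃ e : P.gradedExt n ≃ₗ[Rᵐᵒᵖ] TrivialModule (opGrading 𝓡),
    ∀ (i : ℤ) (φ : (P.ι n →₀ R) →ₗ[R] R) (hφ : φ ∈ P.cocycles n), i ≠ -l →
      P.IsHomogeneousHom n i φ → e (P.extClass φ hφ) = 0

end GradedFreeResolution

/-- `Extⁱ(k, R) = 0` for `i ≠ d` and `Ext^d(k, R) ≅ k(l)` for some `l`, for graded left modules.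
Graded Ext does not depend on the resolution; graded free resolutions always exist. -/
def GorensteinCondition (𝓡 : ℕ → Submodule ℂ R) (d : ℕ) : Prop :=
  ∀ P : GradedFreeResolution 𝓡,
    (∀ i, i ≠ d → Subsingleton (P.gradedExt i)) ∧ ∃ l : ℤ, P.ExtIsoTrivialShift d l

end Graded

/-! ### Quantum polynomial algebras -/

section Algebras

variable {A : Type u} [Ring A] [Algebra ℂ A] (𝒜 : ℕ → Submodule ℂ A)

/-- Connected: `A_0 = ℂ`. -/
def IsConnectedGraded : Prop := Nontrivial A ∧ 𝒜 0 = 1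

/-- Locally finite: every `A_i` is finite dimensional. -/
def IsLocallyFinite : Prop := ∀ i, Module.Finite ℂ (𝒜 i)

/-- A Koszul algebra: locally finite, connected, and the trivial right module has a linear
free resolution. -/
def IsKoszul : Prop :=
  IsConnectedGraded 𝒜 ∧ IsLocallyFinite 𝒜 ∧
    ∃ P : GradedFreeResolution (opGrading 𝒜), P.IsLinear

/-- An Artin-Schelter Gorenstein algebra of injective dimension `d`. The first Gorenstein
condition is the one for right modules, the second the one for left modules. -/
structure IsASGorenstein (d : ℕ) : Prop where
  connected : IsConnectedGraded 𝒜
  injdim_left : injectiveDimension (ModuleCat.of A A) = d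
  injdim_right : injectiveDimension (ModuleCat.of Aᵐᵒᵖ A) = d
  ext_right : GorensteinCondition (opGrading 𝒜) d
  ext_left : GorensteinCondition 𝒜 d

/-- An Artin-Schelter regular algebra. -/
def IsASRegular : Prop :=
  (∃ d, IsASGorenstein 𝒜 d) ∧ globalDimension Aᵐᵒᵖ < ⊤

/-- A quantum polynomial algebra: an Artin-Schelter regular algebra that is a (two-sided)
noetherian domain, Koszul, and has Hilbert series `1 / (1 - t) ^ d` for some `d > 0`. -/
structure IsQuantumPolynomialAlgebra : Prop where
  regular : IsASRegular 𝒜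
  noetherian_left : IsNoetherianRing A
  noetherian_right : IsNoetherianRing Aᵐᵒᵖ
  domain : IsDomain A
  koszul : IsKoszul 𝒜
  hilbert : ∃ d : ℕ, 0 < d ∧
    PowerSeries.mk (fun i => (Module.finrank ℂ (𝒜 i) : ℤ)) * (1 - PowerSeries.X) ^ d = 1

end Algebras

/-! ### Clifford deformations -/

section Clifford

variable {X : Type u} [AddCommGroup X] [Module ℂ X]

/-- The inclusion of `X ⊗ X` into the tensor algebra. -/
def tensorSq (X : Type u) [AddCommGroup X] [Module ℂ X] : X ⊗[ℂ] X →ₗ[ℂ] TensorAlgebra ℂ X :=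
  TensorProduct.lift
    ((LinearMap.mul ℂ (TensorAlgebra ℂ X)).compl₁₂ (TensorAlgebra.ι ℂ) (TensorAlgebra.ι ℂ))

/-- The relations `r = θ(r)`, for `r` in the space of quadratic relations. -/
inductive CliffordRel (RE : Submodule ℂ (X ⊗[ℂ] X)) (θ : RE →ₗ[ℂ] ℂ) :
    TensorAlgebra ℂ X → TensorAlgebra ℂ X → Prop
  | of (r : RE) : CliffordRel RE θ (tensorSq X r) (algebraMap ℂ _ (θ r))

/-- The Clifford deformation `T(X) / (r - θ(r) : r ∈ RE)` of `E = T(X) / (RE)`. -/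
abbrev CliffordDeformation (RE : Submodule ℂ (X ⊗[ℂ] X)) (θ : RE →ₗ[ℂ] ℂ) : Type u :=
  RingQuot (CliffordRel RE θ)

/-- The `ℤ/2`-grading of the Clifford deformation, induced by the parity of tensor degree. -/
def cliffordGrading (RE : Submodule ℂ (X ⊗[ℂ] X)) (θ : RE →ₗ[ℂ] ℂ) (g : ZMod 2) :
    Submodule ℂ (CliffordDeformation RE θ) :=
  (⨆ (k : ℕ) (_ : (k : ZMod 2) = g), LinearMap.range (TensorAlgebra.ι ℂ (M := X)) ^ k).map
    (RingQuot.mkAlgHom ℂ (CliffordRel RE θ)).toLinearMap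

end Clifford

/-! ### The Clifford deformation of a central element of degree two -/

section Quadric

variable {A : Type u} [Ring A] [Algebra ℂ A] (𝒜 : ℕ → Submodule ℂ A)

/-- The multiplication `A_1 ⊗ A_1 ⟶ A`. -/
def mulOne : 𝒜 1 ⊗[ℂ] 𝒜 1 →ₗ[ℂ] A :=
  TensorProduct.lift ((LinearMap.mul ℂ A).compl₁₂ (𝒜 1).subtype (𝒜 1).subtype)

/-- The space `R ⊆ V ⊗ V` of quadratic relations of `A`, where `V = A_1`. -/
def quadraticRelations : Submodule ℂ (𝒜 1 ⊗[ℂ] 𝒜 1) := LinearMap.ker (mulOne 𝒜)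

/-- The relations `R^⊥ ⊆ V^* ⊗ V^*` of the quadratic dual `A^! = T(V^*) / (R^⊥)`. -/
def dualRelations : Submodule ℂ (Module.Dual ℂ (𝒜 1) ⊗[ℂ] Module.Dual ℂ (𝒜 1)) where
  carrier := {α | ∀ r ∈ quadraticRelations 𝒜, TensorProduct.dualDistrib ℂ _ _ α r = 0}
  add_mem' := by
    intro α β hα hβ r hr
    rw [map_add, LinearMap.add_apply, hα r hr, hβ r hr, add_zero]
  zero_mem' := by
    intro r _
    rw [map_zero, LinearMap.zero_apply]
  smul_mem' := by
    intro c α hα r hr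
    rw [map_smul, LinearMap.smul_apply, hα r hr, smul_zero]

/-- The map `α ↦ α(r₀)` on `R^⊥`. -/
def evalRelation (r₀ : 𝒜 1 ⊗[ℂ] 𝒜 1) : dualRelations 𝒜 →ₗ[ℂ] ℂ :=
  (LinearMap.applyₗ r₀ ∘ₗ TensorProduct.dualDistrib ℂ (𝒜 1) (𝒜 1)) ∘ₗ (dualRelations 𝒜).subtype

open Classical in
/-- The map `θ_f : R^⊥ ⟶ ℂ`, `θ_f(α) = α(r₀)`, where `r₀ ∈ V ⊗ V` is a preimage of `f`. -/
def theta (f : A) : dualRelations 𝒜 →ₗ[ℂ] ℂ :=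
  if h : ∃ r₀, mulOne 𝒜 r₀ = f then evalRelation 𝒜 h.choose else 0

/-- `θ_f` does not depend on the choice of the preimage of `f`. -/
theorem theta_eq (f : A) (r₀ : 𝒜 1 ⊗[ℂ] 𝒜 1) (h : mulOne 𝒜 r₀ = f) :
    theta 𝒜 f = evalRelation 𝒜 r₀ := by
  have hex : ∃ r, mulOne 𝒜 r = f := ⟨r₀, h⟩
  rw [theta, dif_pos hex]
  ext α
  have hm : hex.choose - r₀ ∈ quadraticRelations 𝒜 := by
    rw [quadraticRelations, LinearMap.mem_ker, map_sub, hex.choose_spec, h, sub_self]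
  have h0 := α.2 _ hm
  rw [map_sub, sub_eq_zero] at h0
  exact h0

/-- The Clifford deformation `C_{A^!}(θ_f)`. -/
abbrev Cliff (f : A) : Type u := CliffordDeformation (dualRelations 𝒜) (theta 𝒜 f)

/-- The `ℤ/2`-grading of `C_{A^!}(θ_f)`. -/
abbrev cliffGrading (f : A) : ZMod 2 → Submodule ℂ (Cliff 𝒜 f) :=
  cliffordGrading (dualRelations 𝒜) (theta 𝒜 f)

end Quadric

/-! ### Simple `ℤ/2`-graded algebras -/

section Simple

variable {C : Type u} [Ring C] [Algebra ℂ C]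

/-- A simple `ℤ/2`-graded algebra: nonzero, with no graded two-sided ideals except `0` and itself.
-/
def IsSimpleGraded (𝒞 : ZMod 2 → Submodule ℂ C) : Prop :=
  Nontrivial C ∧ ∀ I : TwoSidedIdeal C,
    (∀ x ∈ I, ∃ y ∈ 𝒞 0, ∃ z ∈ 𝒞 1, y ∈ I ∧ z ∈ I ∧ x = y + z) → I = ⊥ ∨ I = ⊤

/-- The grading of the matrix algebra `M_m(D)` over a `ℤ/2`-graded algebra `D`, with degree
shifts `s`: a matrix is homogeneous of degree `g` if its `(i, j)` entry has degree
`g + s i - s j`. -/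
def matrixGrading {D : Type} [Ring D] [Algebra ℂ D] (𝒟 : ZMod 2 → Submodule ℂ D) {m : ℕ}
    (s : Fin m → ZMod 2) (g : ZMod 2) : Submodule ℂ (Matrix (Fin m) (Fin m) D) where
  carrier := {M | ∀ i j, M i j ∈ 𝒟 (g + s i - s j)}
  add_mem' := fun hM hN i j => add_mem (hM i j) (hN i j)
  zero_mem' := fun _ _ => zero_mem _
  smul_mem' := fun c _ hM i j => Submodule.smul_mem _ c (hM i j)

/-- `C` is isomorphic, as a `ℤ/2`-graded algebra, to a matrix algebra over the `ℤ/2`-graded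
algebra `D`, possibly with degree shifts. -/
def IsGradedMatrixAlgebra (𝒞 : ZMod 2 → Submodule ℂ C) {D : Type} [Ring D] [Algebra ℂ D]
    (𝒟 : ZMod 2 → Submodule ℂ D) : Prop :=
  ∃ (m : ℕ) (s : Fin m → ZMod 2) (e : C ≃ₐ[ℂ] Matrix (Fin m) (Fin m) D),
    ∀ g, (𝒞 g).map e.toLinearMap = matrixGrading 𝒟 s g

/-- `ℂ` as a `ℤ/2`-graded algebra concentrated in degree `0`. -/
def complexGrading (g : ZMod 2) : Submodule ℂ ℂ := if g = 0 then ⊤ else ⊥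

/-- The group algebra of the group of order two, with its generator `σ` in degree `1`. -/
abbrev GroupAlgebraTwo : Type := AddMonoidAlgebra ℂ (ZMod 2)

/-- The `ℤ/2`-grading of the group algebra of the group of order two. -/
abbrev groupAlgebraGrading : ZMod 2 → Submodule ℂ GroupAlgebraTwo := AddMonoidAlgebra.grade ℂ

end Simple

section Types

variable {A : Type u} [Ring A] [Algebra ℂ A] (𝒜 : ℕ → Submodule ℂ A) (f : A)

/-- `A/(f)` is a simple graded isolated singularity. -/
def IsSimpleGradedIsolatedSingularity : Prop := IsSimpleGraded (cliffGrading 𝒜 f)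

/-- `A/(f)` is a simple graded isolated singularity of `0`-type. -/
def IsZeroType : Prop :=
  IsSimpleGradedIsolatedSingularity 𝒜 f ∧
    IsGradedMatrixAlgebra (cliffGrading 𝒜 f) complexGrading

/-- `A/(f)` is a simple graded isolated singularity of `1`-type. -/
def IsOneType : Prop :=
  IsSimpleGradedIsolatedSingularity 𝒜 f ∧
    IsGradedMatrixAlgebra (cliffGrading 𝒜 f) groupAlgebraGrading

end Types

end QuadricHypersurface

end

/-!
Write `R = Aᵐᵒᵖ`, so that right `A`-modules are left `R`-modules, and let `P` be the linear free
resolution of the trivial right module that exists because `A` is Koszul.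

The Euler characteristic of the strands of `P` expresses the ranks of the `Pᵏ` through the Hilbert
series `1 / (1 - t) ^ m`: the rank of `Pᵏ` is `m.choose k`
(`GradedFreeResolution.IsLinear.card_eq_choose`), so `P` has length `m` and total rank `2 ^ m`. As
`P` is minimal, its graded dual has cohomology in degree `m`, so the Gorenstein condition forces `m`
to be the injective dimension of `R` (`IsASGorenstein.eq_of_card_eq_choose`). Over a noetherian
ring of finite global dimension that is the global dimension
(`eq_injectiveDimension_of_globalDimension_eq`), whence `m = n`.

For the dimension of the Clifford deformation `C`, multiplication by the central element `f` on `P`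
is null-homotopic, and so are the successive obstructions to turning the differential `δ` into a
square root of `f`. This yields a matrix `D` with entries in `A_1`, leading term `δ` and `D * D = f`
(`IsLinearResolutionMatrix.exists_factorization`). Writing `D = ∑ xₐ Dₐ` for a basis `xₐ` of `A_1`,
the equation `D * D = f` says that `xₐ^* ↦ Dₐᵀ` satisfies the relations of `C`
(`IsLinearFactorization.rep`). Hence `C` acts on the space on the generators of `P`, of dimension
`2 ^ m`. The orbit map of the generator of degree zero is a bijection
(`IsLinearFactorization.orbit_bijective`): on leading terms it is governed by `δ`, and the exactness
of `P` in internal degrees zero and one, dualized, gives surjectivity and injectivity.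

The two parity statements only compare dimensions: a matrix algebra over `ℂ` has dimension `r * r`,
and one over the group algebra of the group of order two has dimension `r * r * 2`.
-/

noncomputable section

namespace QuadricHypersurface

/-! ### Global dimension and injective dimension of a noetherian ring -/

section GlobalDimension

variable {R : Type u} [Ring R]

open Abelian

lemma hasInjectiveDimensionLT_fin_fun {n : ℕ}
    (hR : HasInjectiveDimensionLT (ModuleCat.of R R) n) (r : ℕ) :
    HasInjectiveDimensionLT (ModuleCat.of R (Fin r → R)) n := by
  induction r with
  | zero =>
    have hz : HasInjectiveDimensionLT (ModuleCat.of R (Fin 0 → R)) 0 :=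
      (ModuleCat.isZero_of_subsingleton _).hasInjectiveDimensionLT_zero
    exact hasInjectiveDimensionLT_of_ge _ 0 n (Nat.zero_le n)
  | succ r ih =>
    have : HasInjectiveDimensionLT (ModuleCat.of R R ⊞ ModuleCat.of R (Fin r → R)) n :=
      inferInstance
    exact hasInjectiveDimensionLT_of_iso
      ((ModuleCat.biprodIsoProd (ModuleCat.of R R) (ModuleCat.of R (Fin r → R))).trans
        (Fin.consLinearEquiv R (fun _ => R)).toModuleIso) n

/-- If the injective dimensions of all finite modules are bounded, they are bounded by that of the
ring: a finite module is the quotient of a finite free module by a finite module, so the bound can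
be lowered by one as long as it exceeds the injective dimension of the ring. -/
lemma hasInjectiveDimensionLT_of_finite [IsNoetherianRing R] {d : ℕ}
    (hR : HasInjectiveDimensionLT (ModuleCat.of R R) (d + 1)) (k : ℕ)
    (hk : ∀ N : ModuleCat.{u} R, Module.Finite R N → HasInjectiveDimensionLT N (d + 1 + k))
    (N : ModuleCat.{u} R) [hN : Module.Finite R N] : HasInjectiveDimensionLT N (d + 1) := by
  induction k with
  | zero => exact hk N hN
  | succ k ih =>
    refine ih fun N' hN' => ?_
    obtain ⟨r, f, hf⟩ := Module.Finite.exists_fin' R N'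
    have hS := LinearMap.shortExact_shortComplexKer hf
    refine hS.hasInjectiveDimensionLT_X₃ (d + 1 + k) ?_ ?_
    · have := hasInjectiveDimensionLT_fin_fun hR r
      exact hasInjectiveDimensionLT_of_ge (ModuleCat.of R (Fin r → R)) (d + 1) _ (by lia)
    · exact hk (ModuleCat.of R (LinearMap.ker f)) inferInstance

/-- A finite module over a noetherian ring has projective dimension at most `d` as soon as its
`Ext` groups of degree `d + 1` into finite modules vanish: the extension of the `d`-th syzygy by
the next one splits. -/
lemma hasProjectiveDimensionLT_of_ext_finite [IsNoetherianRing R] (d : ℕ)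
    (M : ModuleCat.{u} R) [Module.Finite R M]
    (h : ∀ N : ModuleCat.{u} R, Module.Finite R N → ∀ e : Ext.{u} M N (d + 1), e = 0) :
    HasProjectiveDimensionLT M (d + 1) := by
  induction d generalizing M with
  | zero =>
    obtain ⟨r, f, hf⟩ := Module.Finite.exists_fin' R M
    have hS := LinearMap.shortExact_shortComplexKer hf
    obtain ⟨s, hs⟩ := Ext.covariant_sequence_exact₃ M hS (Ext.mk₀ (𝟙 M)) (zero_add 1)
      (h (ModuleCat.of R (LinearMap.ker f)) inferInstance _)
    obtain ⟨s, rfl⟩ := Ext.homEquiv₀.symm.surjective s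
    have hs' : s ≫ ModuleCat.ofHom f = 𝟙 M := by
      apply Ext.homEquiv₀.symm.injective
      simpa using hs
    have hproj : Projective (ModuleCat.of R (Fin r → R)) :=
      (IsProjective.iff_projective (R := R) (Fin r → R)).1 inferInstance
    exact (Retract.mk s (ModuleCat.ofHom f) hs').hasProjectiveDimensionLT 1
  | succ d ih =>
    obtain ⟨r, f, hf⟩ := Module.Finite.exists_fin' R M
    have hS := LinearMap.shortExact_shortComplexKer hf
    have hproj : Projective (ModuleCat.of R (Fin r → R)) :=
      (IsProjective.iff_projective (R := R) (Fin r → R)).1 inferInstance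
    rw [hS.hasProjectiveDimensionLT_X₃_iff d hproj]
    refine ih (ModuleCat.of R (LinearMap.ker f)) fun N hN e => ?_
    obtain ⟨x, rfl⟩ := Ext.contravariant_sequence_exact₁ hS N e (add_comm 1 (d + 1)) (h N hN _)
    rw [x.eq_zero_of_hasProjectiveDimensionLT (X := ModuleCat.of R (Fin r → R)) 1 (by lia),
      Ext.comp_zero]

/-- Baer's criterion in terms of `Ext`: the injective dimension is tested on cyclic modules. -/
lemma hasInjectiveDimensionLT_of_ext_cyclic (d : ℕ) (N : ModuleCat.{u} R)
    (h : ∀ (I : Ideal R) (e : Ext.{u} (ModuleCat.of R (R ⧸ I)) N (d + 1)), e = 0) :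
    HasInjectiveDimensionLT N (d + 1) := by
  induction d generalizing N with
  | zero =>
    rw [zero_add, ← injective_iff_hasInjectiveDimensionLT_one,
      ← Module.injective_iff_injective_object R N, ← Module.Baer.iff_injective]
    intro I g
    have hI : Function.Surjective I.mkQ := I.mkQ_surjective
    let S : ShortComplex (ModuleCat.{u} R) :=
      ModuleCat.shortComplexOfCompEqZero I.subtype I.mkQ (by ext; simp)
    have hS : S.ShortExact := ModuleCat.shortComplex_shortExact S
      (LinearMap.exact_subtype_mkQ I) I.injective_subtype hI
    obtain ⟨s, hs⟩ := Ext.contravariant_sequence_exact₁ hS N (Ext.mk₀ (ModuleCat.ofHom g))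
      (add_comm 1 0) (h I _)
    obtain ⟨s, rfl⟩ := Ext.homEquiv₀.symm.surjective s
    have hs' : S.f ≫ s = ModuleCat.ofHom g := by
      apply Ext.homEquiv₀.symm.injective
      simpa using hs
    refine ⟨s.hom, fun x hx => ?_⟩
    exact congrArg (fun t => t.hom ⟨x, hx⟩) hs'
  | succ d ih =>
    obtain ⟨E, _, i, _⟩ := EnoughInjectives.presentation N
    have hS : (ShortComplex.mk _ _ (Limits.cokernel.condition i)).ShortExact :=
      { exact := ShortComplex.exact_cokernel i }
    rw [← hS.hasInjectiveDimensionLT_X₃_iff d inferInstance]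
    refine ih _ fun I e => ?_
    obtain ⟨x, rfl⟩ := Ext.covariant_sequence_exact₃ _ hS e rfl (h I _)
    rw [x.eq_zero_of_hasInjectiveDimensionLT (X := E) 1 (by lia), Ext.zero_comp]

/-- Over a noetherian ring of finite global dimension, the global dimension is the injective
dimension of the ring. -/
theorem eq_injectiveDimension_of_globalDimension_eq [IsNoetherianRing R] {n d : ℕ}
    (hn : globalDimension R = n) (hd : injectiveDimension (ModuleCat.of R R) = d) : n = d := by
  have hpd : ∀ M : ModuleCat.{u} R, HasProjectiveDimensionLT M (n + 1) := fun M => by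
    rw [← HasProjectiveDimensionLE, ← projectiveDimension_le_iff, ← hn]
    exact le_iSup (fun M : ModuleCat.{u} R => projectiveDimension M) M
  have hid : ∀ (k : ℕ) (N : ModuleCat.{u} R), HasInjectiveDimensionLT N (n + 1 + k) :=
    fun k N => HasInjectiveDimensionLT.mk.{u} fun i hi Y e =>
      have := hpd Y
      e.eq_zero_of_hasProjectiveDimensionLT (n + 1) (by lia)
  apply le_antisymm
  · have hR : HasInjectiveDimensionLT (ModuleCat.of R R) (d + 1) := by
      rw [← HasInjectiveDimensionLE, ← injectiveDimension_le_iff, hd]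
    have hfin : ∀ (N : ModuleCat.{u} R) [Module.Finite R N], HasInjectiveDimensionLT N (d + 1) :=
      hasInjectiveDimensionLT_of_finite hR n fun N _ => by
        have := hid d N
        exact hasInjectiveDimensionLT_of_ge N (n + 1 + d) _ (by lia)
    have hcyc : ∀ I : Ideal R, HasProjectiveDimensionLT (ModuleCat.of R (R ⧸ I)) (d + 1) :=
      fun I => hasProjectiveDimensionLT_of_ext_finite d _ fun N hN e => by
        have := hfin N
        exact e.eq_zero_of_hasInjectiveDimensionLT (d + 1) le_rfl
    have hall : ∀ N : ModuleCat.{u} R, HasInjectiveDimensionLT N (d + 1) :=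
      fun N => hasInjectiveDimensionLT_of_ext_cyclic d N fun I e => by
        have := hcyc I
        exact e.eq_zero_of_hasProjectiveDimensionLT (d + 1) le_rfl
    have : globalDimension R ≤ d := iSup_le fun M => by
      rw [projectiveDimension_le_iff]
      exact HasProjectiveDimensionLT.mk.{u} fun i hi Y e => by
        have := hall Y
        exact e.eq_zero_of_hasInjectiveDimensionLT (d + 1) hi
    rw [hn] at this
    exact_mod_cast this
  · have := (injectiveDimension_le_iff (ModuleCat.of R R) n).2 (hid 0 _)
    rw [hd] at this
    exact_mod_cast this

end GlobalDimension

/-! ### The opposite grading and the strands of a linear resolution -/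

section OppositeGrading

variable {A : Type u} [Ring A] [Algebra ℂ A] (𝒜 : ℕ → Submodule ℂ A)

lemma mem_opGrading {i : ℕ} {x : Aᵐᵒᵖ} : x ∈ opGrading 𝒜 i ↔ x.unop ∈ 𝒜 i := by
  constructor
  · rintro ⟨y, hy, rfl⟩
    exact hy
  · intro h
    exact ⟨x.unop, h, rfl⟩

instance opGrading.gradedMonoid [SetLike.GradedMonoid 𝒜] :
    SetLike.GradedMonoid (opGrading 𝒜) where
  one_mem := (mem_opGrading 𝒜).2 (SetLike.GradedOne.one_mem (A := 𝒜))
  mul_mem i j a b ha hb := by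
    rw [mem_opGrading] at *
    rw [MulOpposite.unop_mul, add_comm]
    exact SetLike.GradedMul.mul_mem hb ha

/-- The components of the opposite grading are those of the original grading. -/
def opGradingEquiv (i : ℕ) : 𝒜 i ≃ₗ[ℂ] opGrading 𝒜 i :=
  (MulOpposite.opLinearEquiv ℂ).submoduleMap (𝒜 i)

instance opGrading.gradedAlgebra [GradedAlgebra 𝒜] : GradedAlgebra (opGrading 𝒜) where
  toDecomposition := DirectSum.Decomposition.ofLinearMap (opGrading 𝒜)
    (DirectSum.lmap (fun i => (opGradingEquiv 𝒜 i).toLinearMap) ∘ₗ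
      (DirectSum.decomposeLinearEquiv 𝒜).toLinearMap ∘ₗ
        (MulOpposite.opLinearEquiv ℂ).symm.toLinearMap)
    (by
      have h : DirectSum.coeLinearMap (opGrading 𝒜) ∘ₗ
          DirectSum.lmap (fun i => (opGradingEquiv 𝒜 i).toLinearMap) =
          (MulOpposite.opLinearEquiv ℂ).toLinearMap ∘ₗ DirectSum.coeLinearMap 𝒜 := by
        ext i x
        simp only [LinearMap.comp_apply, DirectSum.lmap_lof, DirectSum.coeLinearMap_lof]
        rfl
      rw [← LinearMap.comp_assoc, h]
      ext x
      exact congrArg MulOpposite.op ((DirectSum.decomposeLinearEquiv 𝒜).symm_apply_apply x.unop))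
    (by
      ext i x : 2
      obtain ⟨y, rfl⟩ := (opGradingEquiv 𝒜 i).surjective x
      simp only [LinearMap.comp_apply, DirectSum.coeLinearMap_lof, LinearMap.id_apply]
      have : DirectSum.decomposeLinearEquiv 𝒜 y = DirectSum.lof ℂ ℕ (fun i => 𝒜 i) i y :=
        DirectSum.decompose_coe 𝒜 y
      change DirectSum.lmap _ (DirectSum.decomposeLinearEquiv 𝒜 y) = _
      rw [this, DirectSum.lmap_lof]
      rfl)

end OppositeGrading

section Connected

variable {R : Type u} [Ring R] [Algebra ℂ R] (𝓡 : ℕ → Submodule ℂ R) [GradedAlgebra 𝓡]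

lemma mem_augIdeal_iff {x : R} : x ∈ augIdeal 𝓡 ↔ GradedRing.proj 𝓡 0 x = 0 := by
  constructor
  · intro hx
    change GradedRing.projZeroRingHom 𝓡 x = 0
    have : augIdeal 𝓡 ≤ RingHom.ker (GradedRing.projZeroRingHom 𝓡) := by
      rw [augIdeal, Ideal.span_le]
      rintro y ⟨i, hi, hy⟩
      exact DirectSum.decompose_of_mem_ne 𝓡 hy hi.ne'
    exact this hx
  · intro hx
    classical
    rw [← DirectSum.sum_support_decompose 𝓡 x]
    refine Submodule.sum_mem _ fun i _ => ?_
    rcases Nat.eq_zero_or_pos i with rfl | hi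
    · rw [GradedRing.proj_apply] at hx
      rw [hx]
      exact zero_mem _
    · exact Ideal.subset_span ⟨i, hi, SetLike.coe_mem _⟩

lemma proj_succ_mul {a b : R} (s : ℕ) (hb : b ∈ 𝓡 1) :
    GradedRing.proj 𝓡 (s + 1) (a * b) = GradedRing.proj 𝓡 s a * b :=
  DirectSum.coe_decompose_mul_add_of_right_mem 𝓡 hb

lemma proj_zero_mul {a b : R} (hb : b ∈ 𝓡 1) : GradedRing.proj 𝓡 0 (a * b) = 0 :=
  DirectSum.coe_decompose_mul_of_right_mem_of_not_le 𝓡 hb (by lia)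

lemma proj_mem (s : ℕ) (a : R) : GradedRing.proj 𝓡 s a ∈ 𝓡 s := SetLike.coe_mem _

lemma proj_of_mem {s : ℕ} {a : R} (ha : a ∈ 𝓡 s) : GradedRing.proj 𝓡 s a = a :=
  DirectSum.decompose_of_mem_same 𝓡 ha

variable {𝓡} in
omit [GradedAlgebra 𝓡] in
lemma exists_algebraMap_of_mem_zero (h : IsConnectedGraded 𝓡) {x : R} (hx : x ∈ 𝓡 0) :
    ∃ c : ℂ, x = algebraMap ℂ R c := by
  rw [h.2] at hx
  obtain ⟨c, hc⟩ := Submodule.mem_one.1 hx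
  exact ⟨c, hc.symm⟩

end Connected

namespace GradedFreeResolution

variable {R : Type u} [Ring R] [Algebra ℂ R] {𝓡 : ℕ → Submodule ℂ R} [GradedAlgebra 𝓡]
  (P : GradedFreeResolution 𝓡)

/-- The strand of `Pⁿ` of the vectors whose coordinates have degree `s`. -/
def strand (n s : ℕ) : Submodule ℂ (P.ι n →₀ R) where
  carrier := {v | ∀ i, v i ∈ 𝓡 s}
  add_mem' hv hw i := add_mem (hv i) (hw i)
  zero_mem' _ := zero_mem _
  smul_mem' c _ hv i := Submodule.smul_mem _ c (hv i)

/-- The differential as a `ℂ`-linear map. -/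
def dC (n : ℕ) : (P.ι (n + 1) →₀ R) →ₗ[ℂ] (P.ι n →₀ R) := (P.d n).restrictScalars ℂ

omit [GradedAlgebra 𝓡] in
lemma d_apply (n : ℕ) (v : P.ι (n + 1) →₀ R) (i : P.ι n) :
    P.d n v i = v.sum fun j a => a * P.d n (Finsupp.single j 1) i := by
  conv_lhs => rw [← v.sum_single]
  rw [Finsupp.sum, map_sum, Finsupp.finsetSum_apply, Finsupp.sum]
  refine Finset.sum_congr rfl fun j _ => ?_
  rw [← mul_one (v j), ← smul_eq_mul, ← Finsupp.smul_single, map_smul]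
  simp

/-- The degree `s` components of the coordinates of a vector. -/
def component (n s : ℕ) (v : P.ι n →₀ R) : P.ι n →₀ R :=
  v.mapRange (GradedRing.proj 𝓡 s) (map_zero _)

lemma component_mem (n s : ℕ) (v : P.ι n →₀ R) : P.component n s v ∈ P.strand n s :=
  fun i => by simp [component]

variable {P}

lemma component_of_mem {n s : ℕ} {v : P.ι n →₀ R} (hv : v ∈ P.strand n s) :
    P.component n s v = v := by
  ext i
  exact proj_of_mem 𝓡 (hv i)

section Linear

variable (hP : P.IsLinear)
include hP

omit [GradedAlgebra 𝓡] in
lemma IsLinear.d_single_mem (n : ℕ) (j : P.ι (n + 1)) (i : P.ι n) :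
    P.d n (Finsupp.single j 1) i ∈ 𝓡 1 := by
  have h := P.d_mem n j i
  have h1 : P.deg (n + 1) j - P.deg n i = Int.ofNat 1 := by
    rw [hP, hP]
    push_cast
    simp
  rwa [h1] at h

lemma IsLinear.d_component_succ (n s : ℕ) (v : P.ι (n + 1) →₀ R) :
    P.d n (P.component (n + 1) s v) = P.component n (s + 1) (P.d n v) := by
  ext i
  rw [component, component, Finsupp.mapRange_apply, d_apply, d_apply, Finsupp.sum_mapRange_index
    (fun _ => zero_mul _), Finsupp.sum, Finsupp.sum, map_sum]
  exact Finset.sum_congr rfl fun j _ => (proj_succ_mul 𝓡 s (hP.d_single_mem n j i)).symm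

lemma IsLinear.component_zero_d (n : ℕ) (v : P.ι (n + 1) →₀ R) :
    P.component n 0 (P.d n v) = 0 := by
  ext i
  rw [component, Finsupp.mapRange_apply, d_apply, Finsupp.sum, map_sum]
  exact Finset.sum_eq_zero fun j _ => proj_zero_mul 𝓡 (hP.d_single_mem n j i)

lemma IsLinear.d_mem_strand {n s : ℕ} {v : P.ι (n + 1) →₀ R} (hv : v ∈ P.strand (n + 1) s) :
    P.d n v ∈ P.strand n (s + 1) := by
  rw [← component_of_mem hv, hP.d_component_succ]
  exact P.component_mem _ _ _

lemma IsLinear.exists_of_d_eq_zero {n s : ℕ} {v : P.ι (n + 1) →₀ R}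
    (hv : v ∈ P.strand (n + 1) (s + 1)) (h : P.d n v = 0) :
    ∃ u ∈ P.strand (n + 2) s, P.d (n + 1) u = v := by
  obtain ⟨u, hu⟩ := (P.exact_succ n v).1 h
  refine ⟨P.component _ s u, P.component_mem _ _ _, ?_⟩
  rw [hP.d_component_succ, hu, component_of_mem hv]

lemma IsLinear.eq_zero_of_d_eq_zero {n : ℕ} {v : P.ι (n + 1) →₀ R}
    (hv : v ∈ P.strand (n + 1) 0) (h : P.d n v = 0) : v = 0 := by
  obtain ⟨u, hu⟩ := (P.exact_succ n v).1 h
  rw [← component_of_mem hv, ← hu, hP.component_zero_d]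

end Linear

/-- Vectors with coordinates of positive degree die in the trivial module. This uses that the left
ideal `augIdeal` is two-sided. -/
lemma ε_eq_zero_of_mem {s : ℕ} {v : P.ι 0 →₀ R} (hv : v ∈ P.strand 0 (s + 1)) : P.ε v = 0 := by
  rw [← v.sum_single, Finsupp.sum, map_sum]
  refine Finset.sum_eq_zero fun j _ => ?_
  rw [← mul_one (v j), ← smul_eq_mul, ← Finsupp.smul_single, map_smul]
  obtain ⟨r, hr⟩ := Submodule.mkQ_surjective (augIdeal 𝓡) (P.ε (Finsupp.single j 1))
  rw [← hr, ← map_smul, Submodule.mkQ_apply, Submodule.Quotient.mk_eq_zero, mem_augIdeal_iff]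
  change GradedRing.projZeroRingHom 𝓡 (v j * r) = 0
  rw [map_mul]
  have : GradedRing.projZeroRingHom 𝓡 (v j) = 0 :=
    DirectSum.decompose_of_mem_ne 𝓡 (hv j) (by lia)
  rw [this, zero_mul]

section Linear

variable (hP : P.IsLinear)
include hP

lemma IsLinear.exists_of_mem_strand_zero {s : ℕ} {v : P.ι 0 →₀ R}
    (hv : v ∈ P.strand 0 (s + 1)) : ∃ u ∈ P.strand 1 s, P.d 0 u = v := by
  obtain ⟨u, hu⟩ := (P.exact_zero v).1 (ε_eq_zero_of_mem hv)
  refine ⟨P.component _ s u, P.component_mem _ _ _, ?_⟩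
  rw [hP.d_component_succ, hu, component_of_mem hv]

lemma IsLinear.eq_zero_of_ε_eq_zero {v : P.ι 0 →₀ R} (hv : v ∈ P.strand 0 0) (h : P.ε v = 0) :
    v = 0 := by
  obtain ⟨u, hu⟩ := (P.exact_zero v).1 h
  rw [← component_of_mem hv, ← hu, hP.component_zero_d]

/-- `P⁰` has rank one, as `P⁰ ⊗ k` is isomorphic to the trivial module `k`. -/
lemma IsLinear.nonempty_unique (h𝓡 : IsConnectedGraded 𝓡) : Nonempty (Unique (P.ι 0)) := by
  have := h𝓡.1
  have hne : Nonempty (P.ι 0) := by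
    by_contra hem
    rw [not_nonempty_iff] at hem
    obtain ⟨v, hv⟩ := P.ε_surjective (Submodule.Quotient.mk 1)
    rw [Subsingleton.elim v 0, map_zero, eq_comm, Submodule.Quotient.mk_eq_zero,
      mem_augIdeal_iff] at hv
    exact one_ne_zero ((map_one (GradedRing.projZeroRingHom 𝓡)).symm.trans hv)
  -- the trivial module is spanned by the class of `1`
  have hc : ∀ i : P.ι 0, ∃ c : ℂ, P.ε (Finsupp.single i 1) =
      c • (Submodule.Quotient.mk 1 : TrivialModule 𝓡) := by
    intro i
    obtain ⟨r, hr⟩ := Submodule.mkQ_surjective (augIdeal 𝓡) (P.ε (Finsupp.single i 1))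
    obtain ⟨c, hc⟩ := exists_algebraMap_of_mem_zero h𝓡 (proj_mem 𝓡 0 r)
    refine ⟨c, ?_⟩
    rw [← hr, ← Submodule.Quotient.mk_smul, Submodule.mkQ_apply, Submodule.Quotient.eq,
      mem_augIdeal_iff, map_sub, hc, ← Algebra.algebraMap_eq_smul_one, proj_of_mem, sub_self]
    rw [← hc]
    exact proj_mem 𝓡 0 r
  choose c hc using hc
  have hsingle : ∀ (i : P.ι 0) (a : ℂ), Finsupp.single i (algebraMap ℂ R a) ∈ P.strand 0 0 := by
    intro i a j
    classical
    rw [Finsupp.single_apply]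
    split_ifs
    · exact SetLike.algebraMap_mem_graded 𝓡 a
    · exact zero_mem _
  have hε : ∀ (i : P.ι 0) (a : ℂ), P.ε (Finsupp.single i (algebraMap ℂ R a)) =
      (a * c i) • (Submodule.Quotient.mk 1 : TrivialModule 𝓡) := by
    intro i a
    rw [← mul_one (algebraMap ℂ R a), ← smul_eq_mul, ← Finsupp.smul_single, map_smul, hc,
      mul_smul, algebraMap_smul]
  have hc0 : ∀ i, c i ≠ 0 := by
    intro i hi
    have := hP.eq_zero_of_ε_eq_zero (hsingle i 1) (by rw [hε, hi, mul_zero, zero_smul])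
    rw [map_one, Finsupp.single_eq_zero] at this
    exact one_ne_zero this
  refine ⟨⟨⟨hne.some⟩, fun i => ?_⟩⟩
  change i = hne.some
  by_contra hij
  have hv := hP.eq_zero_of_ε_eq_zero
    (sub_mem (hsingle i (c hne.some)) (hsingle hne.some (c i)))
    (by rw [map_sub, hε, hε, mul_comm, sub_self])
  have := DFunLike.congr_fun hv i
  rw [Finsupp.sub_apply, Finsupp.single_eq_same, Finsupp.single_eq_of_ne hij, sub_zero,
    Finsupp.zero_apply] at this
  exact hc0 _ ((algebraMap ℂ R).injective (this.trans (map_zero _).symm))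

end Linear

end GradedFreeResolution

/-! ### Betti numbers and the length of the resolution -/

namespace GradedFreeResolution

variable {R : Type u} [Ring R] [Algebra ℂ R] {𝓡 : ℕ → Submodule ℂ R} [GradedAlgebra 𝓡]
  {P : GradedFreeResolution 𝓡}

variable (P) in
/-- The strand as a space of functions, in which dimensions are computed. -/
def strandEquiv (n s : ℕ) [Finite (P.ι n)] : P.strand n s ≃ₗ[ℂ] (P.ι n → 𝓡 s) where
  toFun v i := ⟨v.1 i, v.2 i⟩
  map_add' _ _ := rfl
  map_smul' _ _ := rfl
  invFun w := ⟨Finsupp.equivFunOnFinite.symm fun i => (w i : R), fun i => (w i).2⟩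
  left_inv _ := Subtype.ext (Finsupp.ext fun _ => rfl)
  right_inv _ := rfl

omit [GradedAlgebra 𝓡] in
variable (P) in
lemma finrank_fun (hlf : IsLocallyFinite 𝓡) (n s : ℕ) [Finite (P.ι n)] :
    Module.finrank ℂ (P.ι n → 𝓡 s) = Nat.card (P.ι n) * Module.finrank ℂ (𝓡 s) := by
  have := hlf s
  have := Fintype.ofFinite (P.ι n)
  rw [Module.finrank_pi_fintype, Finset.sum_const, Finset.card_univ, smul_eq_mul,
    Nat.card_eq_fintype_card]

variable (hP : P.IsLinear)
include hP

/-- The terms of a linear resolution have finite rank: `Pⁿ⁺¹` is generated by a space of cycles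
of `Pⁿ` of degree `1` over its generators. -/
lemma IsLinear.finite (h𝓡 : IsConnectedGraded 𝓡) (hlf : IsLocallyFinite 𝓡) (n : ℕ) :
    Finite (P.ι n) := by
  have := h𝓡.1
  induction n with
  | zero =>
    obtain ⟨_⟩ := hP.nonempty_unique h𝓡
    infer_instance
  | succ n ih =>
    have := hlf 1
    let c : (P.ι (n + 1) →₀ ℂ) →ₗ[ℂ] (P.ι (n + 1) →₀ R) :=
      Finsupp.mapRange.linearMap (Algebra.linearMap ℂ R)
    have hc : ∀ v, c v ∈ P.strand (n + 1) 0 := fun v i => by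
      simpa [c] using SetLike.algebraMap_mem_graded 𝓡 (v i)
    have hcinj : Function.Injective c :=
      Finsupp.mapRange_injective _ (map_zero _) (algebraMap ℂ R).injective
    let g : (P.ι (n + 1) →₀ ℂ) →ₗ[ℂ] (P.ι n → 𝓡 1) :=
      (P.strandEquiv n 1).toLinearMap ∘ₗ
        (P.dC n ∘ₗ c).codRestrict _ fun v => hP.d_mem_strand (hc v)
    have hg : LinearIndependent ℂ fun j => g (Finsupp.single j 1) := by
      rw [linearIndependent_iff]
      intro v hv
      have hv' : g v = 0 := by
        rw [← hv, Finsupp.linearCombination_apply, Finsupp.sum]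
        conv_lhs => rw [← v.sum_single, Finsupp.sum, map_sum]
        refine Finset.sum_congr rfl fun j _ => ?_
        rw [← map_smul, Finsupp.smul_single, smul_eq_mul, mul_one]
      have : P.d n (c v) = 0 :=
        congrArg Subtype.val ((P.strandEquiv n 1).injective (hv'.trans (map_zero _).symm))
      exact hcinj ((hP.eq_zero_of_d_eq_zero (hc v) this).trans (map_zero c).symm)
    exact hg.finite

/-- The differential on the strands, in coordinates. -/
def IsLinear.dStrand (n s : ℕ) [Finite (P.ι n)] [Finite (P.ι (n + 1))] :
    (P.ι (n + 1) → 𝓡 s) →ₗ[ℂ] (P.ι n → 𝓡 (s + 1)) :=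
  (P.strandEquiv n (s + 1)).toLinearMap ∘ₗ
    (P.dC n).restrict (fun _ hv => hP.d_mem_strand hv) ∘ₗ
      (P.strandEquiv (n + 1) s).symm.toLinearMap

lemma IsLinear.dStrand_strandEquiv (n s : ℕ) [Finite (P.ι n)] [Finite (P.ι (n + 1))]
    {v : P.ι (n + 1) →₀ R} (hv : v ∈ P.strand (n + 1) s) :
    hP.dStrand n s (P.strandEquiv (n + 1) s ⟨v, hv⟩) =
      P.strandEquiv n (s + 1) ⟨P.d n v, hP.d_mem_strand hv⟩ := by
  simp only [dStrand, LinearMap.comp_apply, LinearEquiv.coe_coe, LinearEquiv.symm_apply_apply]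
  rfl

lemma IsLinear.dStrand_strandEquiv_eq_zero_iff (n s : ℕ) [Finite (P.ι n)] [Finite (P.ι (n + 1))]
    {v : P.ι (n + 1) →₀ R} (hv : v ∈ P.strand (n + 1) s) :
    hP.dStrand n s (P.strandEquiv (n + 1) s ⟨v, hv⟩) = 0 ↔ P.d n v = 0 := by
  rw [dStrand_strandEquiv, LinearEquiv.map_eq_zero_iff]
  exact ⟨fun h => congrArg Subtype.val h, fun h => Subtype.ext h⟩

lemma IsLinear.range_dStrand_succ (n s : ℕ) [Finite (P.ι n)] [Finite (P.ι (n + 1))]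
    [Finite (P.ι (n + 2))] :
    LinearMap.range (hP.dStrand (n + 1) s) = LinearMap.ker (hP.dStrand n (s + 1)) := by
  ext w
  obtain ⟨⟨v, hv⟩, rfl⟩ := (P.strandEquiv (n + 1) (s + 1)).surjective w
  rw [LinearMap.mem_ker, hP.dStrand_strandEquiv_eq_zero_iff]
  constructor
  · rintro ⟨u, h⟩
    obtain ⟨⟨u, hu⟩, rfl⟩ := (P.strandEquiv (n + 2) s).surjective u
    rw [dStrand_strandEquiv] at h
    have h : P.d (n + 1) u = v := congrArg Subtype.val ((P.strandEquiv _ _).injective h)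
    rw [← h]
    exact (P.exact_succ n).apply_apply_eq_zero u
  · intro h
    obtain ⟨u, hu, rfl⟩ := hP.exists_of_d_eq_zero hv h
    exact ⟨_, hP.dStrand_strandEquiv _ _ hu⟩

lemma IsLinear.range_dStrand_zero (s : ℕ) [Finite (P.ι 0)] [Finite (P.ι 1)] :
    LinearMap.range (hP.dStrand 0 s) = ⊤ := by
  rw [LinearMap.range_eq_top]
  intro w
  obtain ⟨⟨v, hv⟩, rfl⟩ := (P.strandEquiv 0 (s + 1)).surjective w
  obtain ⟨u, hu, rfl⟩ := hP.exists_of_mem_strand_zero hv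
  exact ⟨_, hP.dStrand_strandEquiv _ _ hu⟩

lemma IsLinear.ker_dStrand_zero (n : ℕ) [Finite (P.ι n)] [Finite (P.ι (n + 1))] :
    LinearMap.ker (hP.dStrand n 0) = ⊥ := by
  rw [LinearMap.ker_eq_bot']
  intro w h
  obtain ⟨⟨v, hv⟩, rfl⟩ := (P.strandEquiv (n + 1) 0).surjective w
  rw [hP.dStrand_strandEquiv_eq_zero_iff] at h
  rw [LinearEquiv.map_eq_zero_iff]
  exact Subtype.ext (hP.eq_zero_of_d_eq_zero hv h)

/-- The truncated Euler characteristic of a strand is, up to sign, the dimension of the space of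
cycles where it is cut off. -/
lemma IsLinear.sum_range_eq_finrank_ker (hlf : IsLocallyFinite 𝓡)
    [∀ n, Finite (P.ι n)] (n s : ℕ) : ∑ k ∈ Finset.range (n + 2),
      (-1 : ℤ) ^ k * Nat.card (P.ι k) * Module.finrank ℂ (𝓡 (n + 1 + s - k)) =
    (-1) ^ (n + 1) * Module.finrank ℂ (LinearMap.ker (hP.dStrand n s)) := by
  have : ∀ s, Module.Finite ℂ (𝓡 s) := hlf
  induction n generalizing s with
  | zero =>
    have h := (hP.dStrand 0 s).finrank_range_add_finrank_ker
    rw [hP.range_dStrand_zero, finrank_top, P.finrank_fun hlf, P.finrank_fun hlf] at h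
    have h : (_ : ℤ) = _ := congrArg Nat.cast h
    push_cast at h
    rw [Finset.sum_range_succ, Finset.sum_range_one]
    have e1 : 0 + 1 + s - 0 = s + 1 := by lia
    have e2 : 0 + 1 + s - (0 + 1) = s := by lia
    rw [e1, e2]
    linear_combination h
  | succ n ih =>
    have h := (hP.dStrand (n + 1) s).finrank_range_add_finrank_ker
    rw [hP.range_dStrand_succ, P.finrank_fun hlf] at h
    have h : (_ : ℤ) = _ := congrArg Nat.cast h
    push_cast at h
    rw [Finset.sum_range_succ]
    have e1 : n + 1 + 1 + s - (n + 2) = s := by lia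
    have e2 : n + 1 + 1 + s = n + 1 + (s + 1) := by lia
    rw [e1, e2, ih]
    have e3 : (Nat.card (P.ι (n + 1 + 1)) : ℤ) = Nat.card (P.ι (n + 2)) := rfl
    rw [e3] at h
    linear_combination -(-1) ^ (n + 2) * h

/-- The numerical form of Koszul duality: the Betti numbers of the trivial module and the Hilbert
series of the algebra determine each other. -/
lemma IsLinear.mk_mul_mk_eq_one (h𝓡 : IsConnectedGraded 𝓡) (hlf : IsLocallyFinite 𝓡) :
    (PowerSeries.mk fun k => (-1 : ℤ) ^ k * Nat.card (P.ι k)) *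
      (PowerSeries.mk fun i => (Module.finrank ℂ (𝓡 i) : ℤ)) = 1 := by
  have := h𝓡.1
  have := hP.finite h𝓡 hlf
  ext t
  rw [PowerSeries.coeff_mul, PowerSeries.coeff_one]
  simp only [PowerSeries.coeff_mk]
  rw [Finset.Nat.sum_antidiagonal_eq_sum_range_succ
    fun i j => (-1 : ℤ) ^ i * Nat.card (P.ι i) * Module.finrank ℂ (𝓡 j)]
  cases t with
  | zero =>
    obtain ⟨_⟩ := hP.nonempty_unique h𝓡
    have h1 : Module.finrank ℂ (𝓡 0) = 1 := by
      rw [h𝓡.2, Submodule.one_eq_span]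
      exact finrank_span_singleton one_ne_zero
    simp [h1]
  | succ t =>
    have h := hP.sum_range_eq_finrank_ker hlf t 0
    rw [hP.ker_dStrand_zero, finrank_bot] at h
    simpa using h

/-- The Betti numbers of the trivial module are binomial coefficients. -/
lemma IsLinear.card_eq_choose (h𝓡 : IsConnectedGraded 𝓡) (hlf : IsLocallyFinite 𝓡) {m : ℕ}
    (hm : PowerSeries.mk (fun i => (Module.finrank ℂ (𝓡 i) : ℤ)) * (1 - PowerSeries.X) ^ m = 1)
    (k : ℕ) : Nat.card (P.ι k) = m.choose k := by
  have h1 : (PowerSeries.mk fun k => (-1 : ℤ) ^ k * Nat.card (P.ι k)) =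
      (1 - PowerSeries.X) ^ m := by
    calc _ = (PowerSeries.mk fun k => (-1 : ℤ) ^ k * Nat.card (P.ι k)) * _ :=
          (mul_one _).symm.trans (congrArg _ hm.symm)
      _ = _ := by rw [← mul_assoc, hP.mk_mul_mk_eq_one h𝓡 hlf, one_mul]
  -- substitute `-t` for `t`
  have h2 := congrArg (fun p => PowerSeries.coeff k (PowerSeries.evalNegHom p)) h1
  have h3 : PowerSeries.evalNegHom ((1 - PowerSeries.X) ^ m : PowerSeries ℤ) =
      ((1 + Polynomial.X) ^ m : Polynomial ℤ) := by
    rw [map_pow, map_sub, map_one, PowerSeries.evalNegHom_X, sub_neg_eq_add]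
    simp
  simp only [h3, Polynomial.coeff_coe, Polynomial.coeff_one_add_X_pow] at h2
  rw [PowerSeries.evalNegHom, PowerSeries.coeff_rescale, PowerSeries.coeff_mk, ← mul_assoc,
    ← mul_pow] at h2
  simpa using h2

/-- In the top degree of a minimal resolution the graded dual complex has cohomology, since the
coboundaries have coordinates in the augmentation ideal. -/
lemma IsLinear.not_subsingleton_gradedExt (h𝓡 : IsConnectedGraded 𝓡) {m : ℕ}
    [Nonempty (P.ι m)] [IsEmpty (P.ι (m + 1))] : ¬ Subsingleton (P.gradedExt m) := by
  have := h𝓡.1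
  intro hs
  obtain ⟨j⟩ := ‹Nonempty (P.ι m)›
  let φ : (P.ι m →₀ R) →ₗ[R] R := Finsupp.lapply j
  have hφ : φ ∈ P.cochains m := by
    refine Submodule.subset_span ⟨-m, fun i => ?_⟩
    rw [hP, add_neg_cancel]
    classical
    change Finsupp.single i 1 j ∈ 𝓡 0
    rw [Finsupp.single_apply]
    split_ifs
    · exact SetLike.GradedOne.one_mem
    · exact zero_mem _
  have hcoc : φ ∈ P.cocycles m := by
    refine ⟨hφ, ?_⟩
    refine LinearMap.mem_ker.2 ?_
    ext i
    exact isEmptyElim i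
  have h0 : P.extClass φ hcoc = 0 := Subsingleton.elim _ _
  have h1 : φ ∈ P.coboundaries m := by
    have := congrArg Subtype.val h0
    exact (Submodule.Quotient.mk_eq_zero _).1 this
  have hφj : φ (Finsupp.single j 1) = 1 := by simp [φ]
  cases m with
  | zero =>
    rw [(Submodule.mem_bot _).1 h1] at hφj
    exact zero_ne_one hφj
  | succ m =>
    obtain ⟨ψ, -, hψ⟩ := h1
    have h2 : ψ (P.d m (Finsupp.single j 1)) = 1 := by
      exact (LinearMap.congr_fun hψ _).trans hφj
    rw [← (P.d m (Finsupp.single j 1)).sum_single, Finsupp.sum, map_sum] at h2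
    have h3 : GradedRing.projZeroRingHom 𝓡 1 = 0 := by
      rw [← h2, map_sum]
      refine Finset.sum_eq_zero fun i _ => ?_
      rw [← mul_one (P.d m (Finsupp.single j 1) i), ← smul_eq_mul, ← Finsupp.smul_single, map_smul,
        smul_eq_mul, map_mul]
      have : GradedRing.projZeroRingHom 𝓡 (P.d m (Finsupp.single j 1) i) = 0 :=
        DirectSum.decompose_of_mem_ne 𝓡 (hP.d_single_mem m j i) one_ne_zero
      rw [this, zero_mul]
    rw [map_one] at h3
    exact one_ne_zero h3

end GradedFreeResolution

/-! ### The total differential of a linear resolution -/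

section LinearMatrix

variable {R : Type u} [Ring R] [Algebra ℂ R] (𝓡 : ℕ → Submodule ℂ R)

open Matrix

/-- The total differential `δ` of a bounded linear free resolution of the trivial module, as a
matrix acting on row vectors. The basis `J` is the disjoint union of the bases of the terms, and
`deg` is the homological degree. Exactness is required strand by strand, on row vectors with
homogeneous coordinates. -/
structure IsLinearResolutionMatrix {J : Type u} [Fintype J] (deg : J → ℕ) (δ : Matrix J J R) :
    Prop where
  entry_mem : ∀ j i, δ j i ∈ 𝓡 1
  deg_eq : ∀ j i, δ j i ≠ 0 → deg j = deg i + 1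
  sq_eq_zero : δ * δ = 0
  exact : ∀ (s : ℕ) (v : J → R), (∀ j, v j ∈ 𝓡 (s + 1)) → v ᵥ* δ = 0 →
    ∃ u : J → R, (∀ j, u j ∈ 𝓡 s) ∧ u ᵥ* δ = v
  minimal : ∀ v : J → R, (∀ j, v j ∈ 𝓡 0) → v ᵥ* δ = 0 → ∀ j, deg j ≠ 0 → v j = 0
  existsUnique : ∃! j, deg j = 0

end LinearMatrix

namespace GradedFreeResolution

variable {R : Type u} [Ring R] [Algebra ℂ R] {𝓡 : ℕ → Submodule ℂ R} [GradedAlgebra 𝓡]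
  (P : GradedFreeResolution 𝓡)

open Matrix

/-- The matrix of the total differential on `⨁ Pⁿ`. -/
def totalMatrix : Matrix (Σ n, P.ι n) (Σ n, P.ι n) R := fun x y =>
  if h : x.1 = y.1 + 1 then P.d y.1 (Finsupp.single (cast (congrArg P.ι h) x.2) 1) y.2 else 0

/-- The part of a vector of `⨁ Pⁿ` that lies in `Pⁿ`. -/
def part [∀ n, Finite (P.ι n)] (n : ℕ) (v : (Σ n, P.ι n) → R) : P.ι n →₀ R :=
  Finsupp.equivFunOnFinite.symm fun j => v ⟨n, j⟩

omit [GradedAlgebra 𝓡] in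
lemma totalMatrix_succ (n : ℕ) (j : P.ι (n + 1)) (i : P.ι n) :
    P.totalMatrix ⟨n + 1, j⟩ ⟨n, i⟩ = P.d n (Finsupp.single j 1) i := by
  rw [totalMatrix, dif_pos rfl]
  rfl

omit [GradedAlgebra 𝓡] in
lemma vecMul_totalMatrix [Fintype (Σ n, P.ι n)] [∀ n, Finite (P.ι n)] (v : (Σ n, P.ι n) → R)
    (n : ℕ) (i : P.ι n) : (v ᵥ* P.totalMatrix) ⟨n, i⟩ = P.d n (P.part (n + 1) v) i := by
  have := Fintype.ofFinite (P.ι (n + 1))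
  rw [d_apply, Finsupp.sum_fintype _ _ (fun _ => zero_mul _), Matrix.vecMul, dotProduct]
  rw [← Finset.sum_subset (Finset.subset_univ
    (Finset.univ.map (Function.Embedding.sigmaMk (β := P.ι) (n + 1)))), Finset.sum_map]
  · refine Finset.sum_congr rfl fun j _ => ?_
    rw [Function.Embedding.sigmaMk_apply, totalMatrix_succ]
    rfl
  · rintro ⟨k, j⟩ - hk
    rw [totalMatrix, dif_neg, mul_zero]
    rintro (rfl : k = n + 1)
    exact hk (Finset.mem_map.2 ⟨j, Finset.mem_univ _, rfl⟩)

variable {P}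

lemma IsLinear.isLinearResolutionMatrix (hP : P.IsLinear) (h𝓡 : IsConnectedGraded 𝓡)
    [Fintype (Σ n, P.ι n)] [∀ n, Finite (P.ι n)] :
    IsLinearResolutionMatrix 𝓡 Sigma.fst P.totalMatrix where
  entry_mem x y := by
    rw [totalMatrix]
    split_ifs
    · exact hP.d_single_mem _ _ _
    · exact zero_mem _
  deg_eq x y h := by
    by_contra hxy
    exact h (dif_neg hxy)
  sq_eq_zero := by
    ext ⟨m, j⟩ ⟨n, i⟩
    change (P.totalMatrix ⟨m, j⟩ ᵥ* P.totalMatrix) ⟨n, i⟩ = 0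
    rw [vecMul_totalMatrix]
    by_cases h : m = n + 2
    · subst h
      have : P.part (n + 1) (P.totalMatrix ⟨n + 2, j⟩) = P.d (n + 1) (Finsupp.single j 1) := by
        ext k
        exact P.totalMatrix_succ _ _ _
      rw [this, (P.exact_succ n).apply_apply_eq_zero, Finsupp.zero_apply]
    · have : P.part (n + 1) (P.totalMatrix ⟨m, j⟩) = 0 := by
        ext k
        exact dif_neg h
      rw [this, map_zero, Finsupp.zero_apply]
  exact s v hv h := by
    have hex : ∀ n, ∃ u ∈ P.strand (n + 1) s, P.d n u = P.part n v := by
      intro n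
      have hvn : P.part n v ∈ P.strand n (s + 1) := fun i => hv _
      cases n with
      | zero => exact hP.exists_of_mem_strand_zero hvn
      | succ n =>
        refine hP.exists_of_d_eq_zero hvn ?_
        ext i
        rw [← vecMul_totalMatrix, h]
        rfl
    choose u hu huv using hex
    refine ⟨fun x => match x with
      | ⟨0, _⟩ => 0
      | ⟨n + 1, j⟩ => u n j, ?_, ?_⟩
    · rintro ⟨_ | n, j⟩
      · exact zero_mem _
      · exact hu n j
    · ext ⟨n, i⟩
      rw [vecMul_totalMatrix, ← show P.part n v i = v ⟨n, i⟩ from rfl, ← huv n]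
      exact congrArg (fun w => P.d n w i) (Finsupp.ext fun _ => rfl)
  minimal v hv h := by
    rintro ⟨_ | n, j⟩ hj
    · exact absurd rfl hj
    · have h0 := hP.eq_zero_of_d_eq_zero (v := P.part (n + 1) v) (fun i => hv _) (by
        ext i
        rw [← vecMul_totalMatrix, h]
        rfl)
      exact DFunLike.congr_fun h0 j
  existsUnique := by
    obtain ⟨_⟩ := hP.nonempty_unique h𝓡
    refine ⟨⟨0, default⟩, rfl, ?_⟩
    rintro ⟨n, j⟩ (rfl : n = 0)
    rw [Unique.eq_default j]

end GradedFreeResolution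

/-! ### The linear matrix factorization of a central quadric -/

section Factorization

variable {R : Type u} [Ring R] {J : Type u} (deg : J → ℕ)

open Matrix

/-- The additive group of matrices that, acting on row vectors, raise the degree by at least `r`. -/
def raising (r : ℤ) : AddSubgroup (Matrix J J R) where
  carrier := {M | ∀ j i, M j i ≠ 0 → deg j + r ≤ deg i}
  zero_mem' _ _ h := absurd rfl h
  add_mem' {M N} hM hN j i h := by
    by_cases h1 : M j i = 0
    · refine hN j i fun h2 => h ?_
      rw [Matrix.add_apply, h1, h2, add_zero]
    · exact hM j i h1
  neg_mem' {M} hM j i h := hM j i fun h1 => h (by rw [Matrix.neg_apply, h1, neg_zero])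

variable {deg}

lemma raising_antitone {r s : ℤ} (h : r ≤ s) {M : Matrix J J R} (hM : M ∈ raising deg s) :
    M ∈ raising deg r := fun j i hji => by
  have := hM j i hji
  lia

lemma mul_mem_raising [Fintype J] {r s : ℤ} {M N : Matrix J J R} (hM : M ∈ raising deg r)
    (hN : N ∈ raising deg s) : M * N ∈ raising deg (r + s) := by
  intro j i h
  obtain ⟨k, -, hk⟩ := Finset.exists_ne_zero_of_sum_ne_zero (Matrix.mul_apply (M := M) ▸ h)
  have h1 := hM j k (left_ne_zero_of_mul hk)
  have h2 := hN k i (right_ne_zero_of_mul hk)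
  lia

variable [Algebra ℂ R] {𝓡 : ℕ → Submodule ℂ R} [Fintype J] {δ : Matrix J J R}
  (hδ : IsLinearResolutionMatrix 𝓡 deg δ)
include hδ

lemma IsLinearResolutionMatrix.mem_raising : δ ∈ raising deg (-1) := fun j i h => by
  have := hδ.deg_eq j i h
  lia

/-- Exactness for row vectors concentrated in one homological degree. -/
lemma IsLinearResolutionMatrix.exists_of_support {s a : ℕ} {v : J → R} (hv : ∀ j, v j ∈ 𝓡 (s + 1))
    (h : v ᵥ* δ = 0) (hdeg : ∀ j, v j ≠ 0 → deg j = a) :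
    ∃ u : J → R, (∀ j, u j ∈ 𝓡 s) ∧ (∀ j, u j ≠ 0 → deg j = a + 1) ∧ u ᵥ* δ = v := by
  classical
  obtain ⟨u, hu, rfl⟩ := hδ.exact s v hv h
  refine ⟨fun j => if deg j = a + 1 then u j else 0, fun j => ?_, fun j hj => ?_, ?_⟩
  · dsimp only
    split_ifs
    · exact hu j
    · exact zero_mem _
  · by_contra hja
    exact hj (if_neg hja)
  · ext i
    by_cases hi : deg i = a
    · refine Finset.sum_congr rfl fun k _ => ?_
      change (if deg k = a + 1 then u k else 0) * δ k i = u k * δ k i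
      by_cases hk : δ k i = 0
      · rw [hk, mul_zero, mul_zero]
      · rw [if_pos (by rw [hδ.deg_eq k i hk, hi])]
    · have h0 : (u ᵥ* δ) i = 0 := by
        by_contra h0
        exact hi (hdeg i h0)
      rw [h0]
      refine Finset.sum_eq_zero fun k _ => ?_
      change (if deg k = a + 1 then u k else 0) * δ k i = 0
      by_cases hk : δ k i = 0
      · rw [hk, mul_zero]
      · rw [if_neg, zero_mul]
        rw [hδ.deg_eq k i hk]
        lia

/-- A chain endomorphism of non-negative homological degree `r` and internal degree `2` of the
resolution is null-homotopic, by a homotopy of internal degree `1`. In degree `0` no condition on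
the augmentation is needed, because the coordinates have positive degree. -/
lemma IsLinearResolutionMatrix.exists_homotopy {r : ℕ} {g : Matrix J J R}
    (hg : ∀ j i, g j i ∈ 𝓡 2) (hdeg : ∀ j i, g j i ≠ 0 → deg i = deg j + r)
    (hcomm : δ * g = g * δ) [SetLike.GradedMonoid 𝓡] :
    ∃ h : Matrix J J R, (∀ j i, h j i ∈ 𝓡 1) ∧ (∀ j i, h j i ≠ 0 → deg i = deg j + r + 1) ∧
      δ * h + h * δ = g := by
  classical
  -- the rows of the homotopy are constructed by induction on the homological degree
  have key : ∀ N : ℕ, ∃ h : Matrix J J R, (∀ j i, h j i ∈ 𝓡 1) ∧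
      (∀ j i, h j i ≠ 0 → deg i = deg j + r + 1) ∧
      ∀ j, deg j < N → δ j ᵥ* h + h j ᵥ* δ = g j := by
    intro N
    induction N with
    | zero => exact ⟨0, fun _ _ => zero_mem _, fun _ _ h => absurd rfl h, fun j hj => by lia⟩
    | succ N ih =>
      obtain ⟨h, hmem, hdegh, hrow⟩ := ih
      have hex : ∀ j, deg j = N → ∃ u : J → R, (∀ i, u i ∈ 𝓡 1) ∧
          (∀ i, u i ≠ 0 → deg i = N + r + 1) ∧ u ᵥ* δ = g j - δ j ᵥ* h := by
        intro j hj
        refine hδ.exists_of_support ?_ ?_ ?_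
        · intro i
          exact sub_mem (hg j i) (Submodule.sum_mem _ fun k _ =>
            SetLike.GradedMul.mul_mem (hδ.entry_mem j k) (hmem k i))
        · -- the obstruction is a cycle because `g` is a chain map and the homotopy relation
          -- holds in lower degrees
          have h1 : δ j ᵥ* (h * δ) = δ j ᵥ* (g - δ * h) := by
            ext i
            refine Finset.sum_congr rfl fun k _ => ?_
            by_cases hk : δ j k = 0
            · rw [hk, zero_mul, zero_mul]
            · have hk' := hrow k (by have := hδ.deg_eq j k hk; lia)
              congr 1
              change (h k ᵥ* δ) i = g k i - (δ k ᵥ* h) i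
              rw [← hk', Pi.add_apply, add_sub_cancel_left]
          have h2 : δ j ᵥ* δ = 0 := congrFun hδ.sq_eq_zero j
          have h3 : δ j ᵥ* g = g j ᵥ* δ := congrFun hcomm j
          rw [Matrix.sub_vecMul, Matrix.vecMul_vecMul, h1, Matrix.vecMul_sub,
            ← Matrix.vecMul_vecMul, h2, Matrix.zero_vecMul, sub_zero, h3, sub_self]
        · intro i hi
          by_cases h1 : g j i = 0
          · have h2 : (δ j ᵥ* h) i ≠ 0 := fun h2 => hi (by rw [Pi.sub_apply, h1, h2, sub_zero])
            obtain ⟨k, -, hk⟩ := Finset.exists_ne_zero_of_sum_ne_zero h2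
            have h3 := hδ.deg_eq j k (left_ne_zero_of_mul hk)
            have h4 := hdegh k i (right_ne_zero_of_mul hk)
            lia
          · rw [hdeg j i h1, hj]
      choose! u hu hudeg huδ using hex
      have hlow : ∀ j, deg j ≤ N → δ j ᵥ* (Matrix.of fun k => if deg k = N then u k else h k) =
          δ j ᵥ* h := by
        intro j hj
        ext i
        refine Finset.sum_congr rfl fun k _ => ?_
        by_cases hk : δ j k = 0
        · rw [hk, zero_mul, zero_mul]
        · change δ j k * (if deg k = N then u k else h k) i = δ j k * h k i
          rw [if_neg]
          have := hδ.deg_eq j k hk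
          lia
      refine ⟨Matrix.of fun k => if deg k = N then u k else h k, fun j i => ?_, fun j i hji => ?_,
        fun j hj => ?_⟩
      · rw [Matrix.of_apply]
        split_ifs with hjN
        · exact hu j hjN i
        · exact hmem j i
      · rw [Matrix.of_apply] at hji
        split_ifs at hji with hjN
        · rw [hudeg j hjN i hji, hjN]
        · exact hdegh j i hji
      · rw [hlow j (by lia)]
        change _ + (if deg j = N then u j else h j) ᵥ* δ = _
        split_ifs with hjN
        · rw [huδ j hjN, add_sub_cancel]
        · exact hrow j (by lia)
  obtain ⟨h, hmem, hdegh, hrow⟩ := key (Finset.univ.sup deg + 1)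
  refine ⟨h, hmem, hdegh, ?_⟩
  ext j i
  exact congrFun (hrow j (Nat.lt_succ_of_le (Finset.le_sup (Finset.mem_univ j)))) i

/-- The filtered form of `exists_homotopy`: only the leading term has to be a chain map. -/
lemma IsLinearResolutionMatrix.exists_homotopy_mod [SetLike.GradedMonoid 𝓡] {r : ℕ}
    {E : Matrix J J R} (hE : ∀ j i, E j i ∈ 𝓡 2) (hr : E ∈ raising deg r)
    (hcomm : δ * E - E * δ ∈ raising deg r) :
    ∃ h : Matrix J J R, (∀ j i, h j i ∈ 𝓡 1) ∧ h ∈ raising deg (r + 1) ∧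
      E - (δ * h + h * δ) ∈ raising deg (r + 1) := by
  classical
  let g : Matrix J J R := Matrix.of fun j i => if deg i = deg j + r then E j i else 0
  have hgdeg : ∀ j i, g j i ≠ 0 → deg i = deg j + r := fun j i h => by
    by_contra hji
    exact h (if_neg hji)
  have hgE : E - g ∈ raising deg (r + 1) := by
    intro j i h
    have h1 : deg i ≠ deg j + r := fun h1 => h (by simp [g, h1])
    have h2 : E j i ≠ 0 := fun h2 => h (by simp [g, h1, h2])
    have := hr j i h2
    lia
  have hg : δ * g = g * δ := by
    have hmem : δ * g - g * δ ∈ raising deg r := by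
      have h1 := mul_mem_raising hδ.mem_raising hgE
      have h2 := mul_mem_raising hgE hδ.mem_raising
      have e : δ * g - g * δ = δ * E - E * δ - (δ * (E - g) - (E - g) * δ) := by noncomm_ring
      rw [e]
      exact sub_mem hcomm (sub_mem (raising_antitone (by lia) h1) (raising_antitone (by lia) h2))
    -- all entries of the commutator have homological degree `r - 1`
    rw [← sub_eq_zero]
    ext j i
    by_contra h
    have h0 := hmem j i h
    rw [Matrix.sub_apply] at h
    by_cases h1 : (δ * g) j i = 0
    · have h2 : (g * δ) j i ≠ 0 := fun h2 => h (by rw [h1, h2, sub_zero]; rfl)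
      obtain ⟨k, -, hk⟩ := Finset.exists_ne_zero_of_sum_ne_zero (Matrix.mul_apply (M := g) ▸ h2)
      have := hgdeg j k (left_ne_zero_of_mul hk)
      have := hδ.deg_eq k i (right_ne_zero_of_mul hk)
      lia
    · obtain ⟨k, -, hk⟩ := Finset.exists_ne_zero_of_sum_ne_zero (Matrix.mul_apply (M := δ) ▸ h1)
      have := hδ.deg_eq j k (left_ne_zero_of_mul hk)
      have := hgdeg k i (right_ne_zero_of_mul hk)
      lia
  obtain ⟨h, hmem, hdegh, hh⟩ := hδ.exists_homotopy (r := r) (g := g) (fun j i => by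
    simp only [g, Matrix.of_apply]
    split_ifs
    · exact hE j i
    · exact zero_mem _) hgdeg hg
  refine ⟨h, hmem, fun j i hji => ?_, by rwa [hh]⟩
  have := hdegh j i hji
  lia

/-- A central element `f` of degree two has a linear matrix factorization `D * D = f` whose
leading term is the differential of the resolution. -/
theorem IsLinearResolutionMatrix.exists_factorization [SetLike.GradedMonoid 𝓡] [DecidableEq J]
    {f : R} (hf : f ∈ 𝓡 2) (hcentral : ∀ x, Commute f x) :
    ∃ D : Matrix J J R, (∀ j i, D j i ∈ 𝓡 1) ∧ D - δ ∈ raising deg 1 ∧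
      D * D = Matrix.scalar J f := by
  -- the error `f - D * D` is pushed into higher and higher degrees; each error commutes with `D`
  have key : ∀ r : ℕ, ∃ D : Matrix J J R, (∀ j i, D j i ∈ 𝓡 1) ∧ D - δ ∈ raising deg 1 ∧
      Matrix.scalar J f - D * D ∈ raising deg r := by
    intro r
    induction r with
    | zero =>
      refine ⟨δ, hδ.entry_mem, by rw [sub_self]; exact zero_mem _, fun j i h => ?_⟩
      rw [hδ.sq_eq_zero, sub_zero, Matrix.scalar_apply] at h
      have : j = i := by
        by_contra hji
        exact h (Matrix.diagonal_apply_ne _ hji)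
      subst this
      simp
    | succ r ih =>
      obtain ⟨D, hD, hDδ, hE⟩ := ih
      have hcomm : δ * (Matrix.scalar J f - D * D) - (Matrix.scalar J f - D * D) * δ ∈
          raising deg r := by
        have hc : Matrix.scalar J f * D = D * Matrix.scalar J f :=
          Matrix.scalar_commute f hcentral D
        have e : δ * (Matrix.scalar J f - D * D) - (Matrix.scalar J f - D * D) * δ =
            (Matrix.scalar J f - D * D) * (D - δ) - (D - δ) * (Matrix.scalar J f - D * D) := by
          rw [mul_sub (Matrix.scalar J f - D * D), sub_mul D δ, mul_sub D, sub_mul _ _ D, hc,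
            mul_assoc]
          abel
        rw [e]
        exact sub_mem (raising_antitone (by lia) (mul_mem_raising hE hDδ))
          (raising_antitone (by lia) (mul_mem_raising hDδ hE))
      obtain ⟨h, hmem, hh, hEh⟩ := hδ.exists_homotopy_mod (fun j i => by
        refine sub_mem ?_ (Submodule.sum_mem _ fun k _ =>
          SetLike.GradedMul.mul_mem (hD j k) (hD k i))
        rw [Matrix.scalar_apply, Matrix.diagonal_apply]
        split_ifs
        · exact hf
        · exact zero_mem _) hE hcomm
      refine ⟨D + h, fun j i => add_mem (hD j i) (hmem j i), ?_, ?_⟩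
      · rw [add_sub_right_comm]
        exact add_mem hDδ (raising_antitone (by lia) hh)
      · have e : Matrix.scalar J f - (D + h) * (D + h) =
            (Matrix.scalar J f - D * D - (δ * h + h * δ)) -
              ((D - δ) * h + h * (D - δ) + h * h) := by noncomm_ring
        rw [e]
        push_cast
        refine sub_mem hEh (add_mem (add_mem ?_ ?_) ?_)
        · exact raising_antitone (by lia) (mul_mem_raising hDδ hh)
        · exact raising_antitone (by lia) (mul_mem_raising hh hDδ)
        · exact raising_antitone (by lia) (mul_mem_raising hh hh)
  obtain ⟨D, hD, hDδ, hE⟩ := key (Finset.univ.sup deg + 1)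
  refine ⟨D, hD, hDδ, ?_⟩
  rw [eq_comm, ← sub_eq_zero]
  ext j i
  by_contra h
  have h1 := hE j i h
  have h2 : deg i ≤ Finset.univ.sup deg := Finset.le_sup (Finset.mem_univ i)
  lia

end Factorization

/-! ### The representation given by a matrix factorization -/

section CliffordModule

variable {A : Type u} [Ring A] [Algebra ℂ A] {𝒜 : ℕ → Submodule ℂ A}

open Matrix

/-- A linear matrix factorization `D` of `f`, acting on row vectors over `Aᵐᵒᵖ`, whose leading term
is the differential `δ` of a linear resolution of the trivial right module. All entries are taken
in `A_1`, so the product of two matrices is the opposite of the product over `A`. -/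
structure IsLinearFactorization (𝒜 : ℕ → Submodule ℂ A) (f : A) {J : Type u} [Fintype J]
    [DecidableEq J] (deg : J → ℕ) (D δ : J → J → 𝒜 1) : Prop where
  resolution : IsLinearResolutionMatrix (opGrading 𝒜) deg
    (Matrix.of fun j i => MulOpposite.op (δ j i : A))
  deg_lt : ∀ j i, D j i ≠ δ j i → deg j < deg i
  sq : ∀ j i, ∑ k, (D k i : A) * D j k = if j = i then f else 0

/-- A functional that vanishes on the kernel of a linear map factors through it. -/
lemma exists_dual_comp_eq {U W : Type*} [AddCommGroup U] [Module ℂ U] [AddCommGroup W] [Module ℂ W]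
    (g : U →ₗ[ℂ] W) (φ : Module.Dual ℂ U) (hφ : ∀ x, g x = 0 → φ x = 0) :
    ∃ ψ : Module.Dual ℂ W, ∀ x, ψ (g x) = φ x := by
  have : φ ∈ LinearMap.range g.dualMap := by
    rw [LinearMap.range_dualMap_eq_dualAnnihilator_ker, Submodule.mem_dualAnnihilator]
    exact hφ
  obtain ⟨ψ, rfl⟩ := this
  exact ⟨ψ, fun _ => rfl⟩

lemma mulOne_tmul (x y : 𝒜 1) : mulOne 𝒜 (x ⊗ₜ y) = (x : A) * y := rfl

variable {f : A} {J : Type u}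

/-- The matrix of the values of a functional on the entries of a matrix, transposed. -/
def evalMatrix (D : J → J → 𝒜 1) : Module.Dual ℂ (𝒜 1) →ₗ[ℂ] Matrix J J ℂ where
  toFun ξ := Matrix.of fun l j => ξ (D j l)
  map_add' _ _ := rfl
  map_smul' _ _ := rfl

lemma single_vecMul_evalMatrix [Fintype J] [DecidableEq J] (D : J → J → 𝒜 1)
    (ξ : Module.Dual ℂ (𝒜 1)) (l j : J) : (Pi.single l 1 ᵥ* evalMatrix D ξ) j = ξ (D j l) := by
  rw [Matrix.single_one_vecMul]
  rfl

lemma lift_evalMatrix_tensorSq [Fintype J] [DecidableEq J] (D : J → J → 𝒜 1)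
    (α : Module.Dual ℂ (𝒜 1) ⊗[ℂ] Module.Dual ℂ (𝒜 1)) (l j : J) :
    TensorAlgebra.lift ℂ (evalMatrix D) (tensorSq _ α) l j =
      TensorProduct.dualDistrib ℂ _ _ α (∑ k, D k l ⊗ₜ D j k) := by
  induction α with
  | zero => simp
  | add α β hα hβ => rw [map_add, map_add, map_add, Matrix.add_apply, hα, hβ, LinearMap.add_apply]
  | tmul ξ η =>
    have : tensorSq (Module.Dual ℂ (𝒜 1)) (ξ ⊗ₜ η) =
      TensorAlgebra.ι ℂ ξ * TensorAlgebra.ι ℂ η := rfl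
    rw [this, map_mul, TensorAlgebra.lift_ι_apply, TensorAlgebra.lift_ι_apply, Matrix.mul_apply,
      map_sum]
    exact Finset.sum_congr rfl fun k _ => (TensorProduct.dualDistrib_apply _ _ _ _).symm

variable [Fintype J] [DecidableEq J] {deg : J → ℕ} {D δ : J → J → 𝒜 1}
  (h : IsLinearFactorization 𝒜 f deg D δ)

include h in
lemma IsLinearFactorization.mulOne_sum (j l : J) :
    mulOne 𝒜 (∑ k, D k l ⊗ₜ D j k) = if j = l then f else 0 := by
  rw [map_sum, ← h.sq]
  rfl

/-- The representation of the Clifford deformation given by a linear matrix factorization: if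
`D = ∑ xₐ Dₐ` for a basis `xₐ` of `A_1`, the dual basis acts by the transposes of the `Dₐ`. The
relations hold because `D * D = f`. -/
def IsLinearFactorization.rep : Cliff 𝒜 f →ₐ[ℂ] Matrix J J ℂ :=
  RingQuot.liftAlgHom ℂ ⟨TensorAlgebra.lift ℂ (evalMatrix D), by
    rintro _ _ ⟨α⟩
    ext l j
    rw [lift_evalMatrix_tensorSq, AlgHom.commutes, Matrix.algebraMap_matrix_apply]
    split_ifs with hlj
    · subst hlj
      rw [theta_eq 𝒜 f (∑ k, D k l ⊗ₜ D l k) (by rw [h.mulOne_sum, if_pos rfl])]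
      rfl
    · refine α.2 _ (LinearMap.mem_ker.2 ?_)
      rw [h.mulOne_sum, if_neg (Ne.symm hlj)]⟩

variable (𝒜 f) in
/-- The generators of the Clifford deformation. -/
def cliffι : Module.Dual ℂ (𝒜 1) →ₗ[ℂ] Cliff 𝒜 f :=
  (RingQuot.mkAlgHom ℂ (CliffordRel (dualRelations 𝒜) (theta 𝒜 f))).toLinearMap ∘ₗ
    TensorAlgebra.ι ℂ

lemma IsLinearFactorization.rep_cliffι (ξ : Module.Dual ℂ (𝒜 1)) :
    h.rep (cliffι 𝒜 f ξ) = evalMatrix D ξ :=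
  (RingQuot.liftAlgHom_mkAlgHom_apply ℂ _ _ _).trans (TensorAlgebra.lift_ι_apply _ _)

variable (𝒜 f) in
/-- The filtration of the Clifford deformation: `cliffFil k` is spanned by the products of fewer
than `k` generators. -/
def cliffFil : ℕ → Submodule ℂ (Cliff 𝒜 f)
  | 0 => ⊥
  | k + 1 => (1 ⊔ LinearMap.range (cliffι 𝒜 f)) ^ k

lemma cliffFil_le_succ (k : ℕ) : cliffFil 𝒜 f k ≤ cliffFil 𝒜 f (k + 1) := by
  cases k with
  | zero => exact bot_le
  | succ k =>
    rw [cliffFil, cliffFil, pow_succ]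
    exact le_mul_of_one_le_right' le_sup_left

lemma cliffFil_mono : Monotone (cliffFil 𝒜 f) := monotone_nat_of_le_succ cliffFil_le_succ

lemma cliffFil_mul_cliffι {k : ℕ} {c : Cliff 𝒜 f} (hc : c ∈ cliffFil 𝒜 f k)
    (ξ : Module.Dual ℂ (𝒜 1)) : c * cliffι 𝒜 f ξ ∈ cliffFil 𝒜 f (k + 1) := by
  cases k with
  | zero =>
    rw [(Submodule.mem_bot ℂ).1 hc, zero_mul]
    exact zero_mem _
  | succ k =>
    rw [cliffFil, pow_succ]
    exact Submodule.mul_mem_mul hc (le_sup_right (a := (1 : Submodule ℂ (Cliff 𝒜 f))) ⟨ξ, rfl⟩)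

lemma cliffFil_succ_succ (k : ℕ) : cliffFil 𝒜 f (k + 2) =
    cliffFil 𝒜 f (k + 1) ⊔ cliffFil 𝒜 f (k + 1) * LinearMap.range (cliffι 𝒜 f) := by
  rw [cliffFil, cliffFil, pow_succ, Submodule.mul_sup, mul_one]

lemma exists_mem_cliffFil (c : Cliff 𝒜 f) : ∃ k, c ∈ cliffFil 𝒜 f (k + 1) := by
  obtain ⟨t, rfl⟩ := RingQuot.mkAlgHom_surjective ℂ _ c
  induction t using TensorAlgebra.induction with
  | algebraMap r =>
    refine ⟨0, ?_⟩
    rw [AlgHom.commutes, cliffFil, pow_zero]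
    exact Submodule.algebraMap_mem r
  | ι ξ =>
    refine ⟨1, ?_⟩
    rw [cliffFil, pow_one]
    exact le_sup_right (a := (1 : Submodule ℂ (Cliff 𝒜 f))) ⟨ξ, rfl⟩
  | mul a b ha hb =>
    obtain ⟨k, hk⟩ := ha
    obtain ⟨l, hl⟩ := hb
    refine ⟨k + l, ?_⟩
    rw [map_mul, cliffFil, pow_add]
    exact Submodule.mul_mem_mul hk hl
  | add a b ha hb =>
    obtain ⟨k, hk⟩ := ha
    obtain ⟨l, hl⟩ := hb
    refine ⟨k + l, ?_⟩
    rw [map_add]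
    exact add_mem (cliffFil_mono (by lia) hk) (cliffFil_mono (by lia) hl)

/-- The row vectors concentrated in degrees less than `k`. -/
def lowVectors (deg : J → ℕ) (k : ℕ) : Submodule ℂ (J → ℂ) where
  carrier := {v | ∀ l, k ≤ deg l → v l = 0}
  zero_mem' _ _ := rfl
  add_mem' hv hw l hl := by rw [Pi.add_apply, hv l hl, hw l hl, add_zero]
  smul_mem' c v hv l hl := by rw [Pi.smul_apply, hv l hl, smul_zero]

omit [Fintype J] [DecidableEq J] in
lemma lowVectors_mono : Monotone (lowVectors deg) := fun _ _ hkl _ hv l hl => hv l (hkl.trans hl)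

include h

lemma IsLinearFactorization.deg_eq {j i : J} (hji : δ j i ≠ 0) : deg j = deg i + 1 := by
  refine h.resolution.deg_eq j i fun h0 => hji ?_
  exact Subtype.ext (MulOpposite.op_injective h0)

/-- On leading terms, the factorization acts through the differential of the resolution. -/
lemma IsLinearFactorization.apply_eq_of_deg {j l : J} (hjl : deg l ≤ deg j) : D j l = δ j l := by
  by_contra hne
  have := h.deg_lt j l hne
  lia

lemma IsLinearFactorization.vecMul_mem_lowVectors {k : ℕ} {v : J → ℂ}
    (hv : v ∈ lowVectors deg k) (ξ : Module.Dual ℂ (𝒜 1)) :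
    v ᵥ* evalMatrix D ξ ∈ lowVectors deg (k + 1) := by
  intro j hj
  refine Finset.sum_eq_zero fun l _ => ?_
  change v l * ξ (D j l) = 0
  by_cases hl : k ≤ deg l
  · rw [hv l hl, zero_mul]
  · rw [h.apply_eq_of_deg (by lia)]
    by_cases h0 : δ j l = 0
    · rw [h0, map_zero, mul_zero]
    · have := h.deg_eq h0
      lia

variable {j₀ : J} (hj₀ : deg j₀ = 0)

variable (j₀) in
/-- The orbit map of the generator of degree zero. -/
def IsLinearFactorization.orbit : Cliff 𝒜 f →ₗ[ℂ] (J → ℂ) where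
  toFun c := Pi.single j₀ 1 ᵥ* h.rep c
  map_add' c c' := by rw [map_add, Matrix.vecMul_add]
  map_smul' r c := by rw [map_smul, Matrix.vecMul_smul, RingHom.id_apply]

omit h in
lemma IsLinearFactorization.orbit_mul_cliffι (h : IsLinearFactorization 𝒜 f deg D δ)
    (c : Cliff 𝒜 f) (ξ : Module.Dual ℂ (𝒜 1)) :
    h.orbit j₀ (c * cliffι 𝒜 f ξ) = h.orbit j₀ c ᵥ* evalMatrix D ξ := by
  change _ ᵥ* h.rep _ = (_ ᵥ* h.rep _) ᵥ* _
  rw [map_mul, rep_cliffι, Matrix.vecMul_vecMul]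

omit h in
lemma IsLinearFactorization.orbit_one (h : IsLinearFactorization 𝒜 f deg D δ) :
    h.orbit j₀ 1 = Pi.single j₀ 1 := by
  change _ ᵥ* h.rep _ = _
  rw [map_one, Matrix.vecMul_one]

include hj₀

omit h in
lemma IsLinearFactorization.orbit_mem_lowVectors (h : IsLinearFactorization 𝒜 f deg D δ)
    {k : ℕ} {c : Cliff 𝒜 f} (hc : c ∈ cliffFil 𝒜 f k) :
    h.orbit j₀ c ∈ lowVectors deg k := by
  cases k with
  | zero =>
    rw [(Submodule.mem_bot ℂ).1 hc, map_zero]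
    exact zero_mem _
  | succ k =>
    induction k generalizing c with
    | zero =>
      rw [cliffFil, pow_zero] at hc
      obtain ⟨r, rfl⟩ := Submodule.mem_one.1 hc
      rw [Algebra.algebraMap_eq_smul_one, map_smul, orbit_one]
      refine Submodule.smul_mem _ _ fun l hl => ?_
      rw [Pi.single_eq_of_ne]
      rintro rfl
      lia
    | succ k ih =>
      rw [cliffFil_succ_succ] at hc
      have hle : cliffFil 𝒜 f (k + 1) ⊔ cliffFil 𝒜 f (k + 1) * LinearMap.range (cliffι 𝒜 f) ≤
          (lowVectors deg (k + 2)).comap (h.orbit j₀) := by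
        refine sup_le (fun c hc => lowVectors_mono (Nat.le_succ _) (ih hc)) ?_
        rw [Submodule.mul_le]
        rintro c hc _ ⟨ξ, rfl⟩
        rw [Submodule.mem_comap, orbit_mul_cliffι]
        exact h.vecMul_mem_lowVectors (ih hc) ξ
      exact hle hc

end CliffordModule

/-! ### Dual exactness and the quadratic relations -/

section CliffordDimension

variable {A : Type u} [Ring A] [Algebra ℂ A] {𝒜 : ℕ → Submodule ℂ A} [GradedAlgebra 𝒜]
  {f : A} {J : Type u} [Fintype J] [DecidableEq J] {deg : J → ℕ} {D δ : J → J → 𝒜 1}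

open Matrix

omit [GradedAlgebra 𝒜] in
lemma exists_algebraMap_of_mem_opGrading_zero (hconn : IsConnectedGraded 𝒜) {x : Aᵐᵒᵖ}
    (hx : x ∈ opGrading 𝒜 0) : ∃ c : ℂ, x = algebraMap ℂ Aᵐᵒᵖ c := by
  obtain ⟨c, hc⟩ := exists_algebraMap_of_mem_zero hconn ((mem_opGrading 𝒜).1 hx)
  exact ⟨c, MulOpposite.unop_injective hc⟩

/-- The dual of the injectivity of the differential on generators of positive degree: every
functional on the generators of degree `k + 1` comes from the generators of degree `k` and
functionals on `A_1`. -/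
lemma IsLinearFactorization.exists_sum_apply_eq [Nontrivial A]
    (h : IsLinearFactorization 𝒜 f deg D δ) {k : ℕ} (u : J → ℂ)
    (hu : ∀ j, deg j ≠ k + 1 → u j = 0) :
    ∃ φ : J → Module.Dual ℂ (𝒜 1), (∀ l, deg l ≠ k → φ l = 0) ∧ ∀ j, ∑ l, φ l (δ j l) = u j := by
  let g : (J → ℂ) →ₗ[ℂ] (J → 𝒜 1) := Fintype.linearCombination ℂ δ
  let û : Module.Dual ℂ (J → ℂ) := Fintype.linearCombination ℂ u
  obtain ⟨ψ, hψ⟩ := exists_dual_comp_eq g û fun v hv => by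
    have hmin := h.resolution.minimal (fun j => algebraMap ℂ Aᵐᵒᵖ (v j))
      (fun j => SetLike.algebraMap_mem_graded (opGrading 𝒜) (v j)) (by
        ext l
        have hl := congrArg Subtype.val (congrFun hv l)
        rw [Fintype.linearCombination_apply, Finset.sum_apply, AddSubmonoidClass.coe_finsetSum]
          at hl
        apply MulOpposite.unop_injective
        rw [Pi.zero_apply, MulOpposite.unop_zero]
        refine Eq.trans ?_ hl
        rw [Matrix.vecMul, dotProduct, Finset.unop_sum]
        refine Finset.sum_congr rfl fun j _ => ?_
        rw [← Algebra.smul_def]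
        rfl)
    rw [Fintype.linearCombination_apply]
    refine Finset.sum_eq_zero fun j _ => ?_
    by_cases hj : deg j = k + 1
    · have : v j = 0 := by
        have h0 := hmin j (by lia)
        exact (algebraMap ℂ Aᵐᵒᵖ).injective (h0.trans (map_zero _).symm)
      rw [this, zero_smul]
    · rw [hu j hj, smul_zero]
  refine ⟨fun l => if deg l = k then ψ ∘ₗ LinearMap.single ℂ (fun _ => 𝒜 1) l else 0,
    fun l hl => if_neg hl, fun j => ?_⟩
  by_cases hj : deg j = k + 1
  · have h1 : ψ (δ j) = u j := by
      have := hψ (Pi.single j 1)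
      simpa [g, û, Fintype.linearCombination_apply_single] using this
    rw [← h1, ← Finset.univ_sum_single (δ j), map_sum]
    refine Finset.sum_congr rfl fun l _ => ?_
    by_cases h0 : δ j l = 0
    · rw [Finset.univ_sum_single, h0, map_zero, Pi.single_zero, map_zero]
    · beta_reduce
      rw [Finset.univ_sum_single, if_pos (by have := h.deg_eq h0; lia)]
      rfl
  · rw [hu j hj]
    refine Finset.sum_eq_zero fun l _ => ?_
    by_cases h0 : δ j l = 0
    · rw [h0, map_zero]
    · beta_reduce
      rw [if_neg (by have := h.deg_eq h0; lia), LinearMap.zero_apply]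

/-- The functional `x ↦ ψ (y * x)` on `A_1`. -/
def dualMulLeft (ψ : Module.Dual ℂ A) : 𝒜 1 →ₗ[ℂ] Module.Dual ℂ (𝒜 1) :=
  ((LinearMap.mul ℂ A).compl₁₂ (𝒜 1).subtype (𝒜 1).subtype).compr₂ ψ

omit [GradedAlgebra 𝒜] in
lemma dualMulLeft_apply (ψ : Module.Dual ℂ A) (y x : 𝒜 1) :
    dualMulLeft ψ y x = ψ ((y : A) * x) := rfl

omit [GradedAlgebra 𝒜] in
/-- The dual of the exactness of the resolution in internal degree one: the linear relations
between the generators of degree `k` come from the relations `ψ (x * y)` in degree `k - 1`. -/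
lemma IsLinearFactorization.exists_dualMulLeft_eq (h : IsLinearFactorization 𝒜 f deg D δ)
    (hconn : IsConnectedGraded 𝒜) {k : ℕ} (w : J → Module.Dual ℂ (𝒜 1))
    (hw : ∀ l, deg l ≠ k → w l = 0) (h0 : ∀ j, ∑ l, w l (δ j l) = 0) :
    ∃ ψ : J → Module.Dual ℂ A, (∀ i, deg i + 1 ≠ k → ψ i = 0) ∧
      ∀ l, ∑ i, dualMulLeft (ψ i) (δ l i) = w l := by
  let g : (J → 𝒜 1) →ₗ[ℂ] (J → A) := LinearMap.pi fun i =>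
    ∑ l, LinearMap.mulLeft ℂ (δ l i : A) ∘ₗ (𝒜 1).subtype ∘ₗ LinearMap.proj l
  have hg : ∀ v i, g v i = ∑ l, (δ l i : A) * v l := fun v i => by simp [g]
  let ŵ : Module.Dual ℂ (J → 𝒜 1) := ∑ l, w l ∘ₗ LinearMap.proj l
  have hŵ : ∀ v, ŵ v = ∑ l, w l (v l) := fun v => by simp [ŵ]
  obtain ⟨ψ, hψ⟩ := exists_dual_comp_eq g ŵ fun v hv => by
    obtain ⟨u, hu, huv⟩ := h.resolution.exact 0 (fun l => MulOpposite.op (v l : A))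
      (fun l => (mem_opGrading 𝒜).2 (v l).2) (by
        ext i
        apply MulOpposite.unop_injective
        rw [Pi.zero_apply, MulOpposite.unop_zero, ← show g v i = 0 from congrFun hv i, hg,
          Matrix.vecMul, dotProduct, Finset.unop_sum]
        rfl)
    choose c hc using fun j => exists_algebraMap_of_mem_opGrading_zero hconn (hu j)
    have hv' : ∀ l, v l = ∑ j, c j • δ j l := fun l => by
      apply Subtype.ext
      apply MulOpposite.op_injective
      rw [← show _ = MulOpposite.op (v l : A) from congrFun huv l, Matrix.vecMul, dotProduct,
        AddSubmonoidClass.coe_finsetSum, Finset.op_sum]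
      refine Finset.sum_congr rfl fun j _ => ?_
      rw [hc, ← Algebra.smul_def]
      rfl
    rw [hŵ]
    simp_rw [hv', map_sum, map_smul]
    rw [Finset.sum_comm]
    refine Finset.sum_eq_zero fun j _ => ?_
    rw [← Finset.smul_sum, h0, smul_zero]
  refine ⟨fun i => if deg i + 1 = k then ψ ∘ₗ LinearMap.single ℂ (fun _ => A) i else 0,
    fun i hi => if_neg hi, fun l => ?_⟩
  ext x
  rw [LinearMap.sum_apply]
  by_cases hl : deg l = k
  · have h1 := hψ (Pi.single l x)
    have h2 : g (Pi.single l x) = fun i => (δ l i : A) * x := by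
      ext i
      rw [hg, Finset.sum_eq_single l, Pi.single_eq_same]
      · intro l' _ hl'
        rw [Pi.single_eq_of_ne hl', ZeroMemClass.coe_zero, mul_zero]
      · exact fun hn => absurd (Finset.mem_univ l) hn
    have h3 : ŵ (Pi.single l x) = w l x := by
      rw [hŵ, Finset.sum_eq_single l, Pi.single_eq_same]
      · intro l' _ hl'
        rw [Pi.single_eq_of_ne hl', map_zero]
      · exact fun hn => absurd (Finset.mem_univ l) hn
    rw [← h3, ← h1, h2, ← Finset.univ_sum_single fun i => (δ l i : A) * x, map_sum]
    refine Finset.sum_congr rfl fun i _ => ?_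
    rw [dualMulLeft_apply]
    by_cases hli : δ l i = 0
    · rw [hli, ZeroMemClass.coe_zero, zero_mul, map_zero, Pi.single_zero, map_zero]
    · beta_reduce
      rw [if_pos (by have := h.deg_eq hli; lia)]
      rfl
  · rw [hw l hl, LinearMap.zero_apply]
    refine Finset.sum_eq_zero fun i _ => ?_
    rw [dualMulLeft_apply]
    by_cases hli : δ l i = 0
    · rw [hli, ZeroMemClass.coe_zero, zero_mul, map_zero]
    · beta_reduce
      rw [if_neg (by have := h.deg_eq hli; lia), LinearMap.zero_apply]

omit [GradedAlgebra 𝒜] in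
variable (f) in
/-- The defining relation of the Clifford deformation for the element of `R^⊥` that corresponds to
a functional `ψ` on `A_2`. -/
lemma exists_sum_cliffι_mul_cliffι {κ : Type*} [Fintype κ] (b : Module.Basis κ ℂ (𝒜 1))
    (ψ : Module.Dual ℂ A) : ∃ c : ℂ,
    ∑ a, cliffι 𝒜 f (b.coord a) * cliffι 𝒜 f (dualMulLeft ψ (b a)) = algebraMap ℂ _ c := by
  let α := ∑ a, b.coord a ⊗ₜ[ℂ] dualMulLeft ψ (b a)
  have hα : TensorProduct.dualDistrib ℂ _ _ α = ψ ∘ₗ mulOne 𝒜 := by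
    ext x y
    simp only [α, map_sum, LinearMap.sum_apply, TensorProduct.AlgebraTensorModule.curry_apply,
      LinearMap.restrictScalars_self, TensorProduct.curry_apply, TensorProduct.dualDistrib_apply,
      LinearMap.comp_apply, mulOne_tmul]
    rw [← dualMulLeft_apply]
    conv_rhs => rw [← b.sum_repr x, map_sum, LinearMap.sum_apply]
    refine Finset.sum_congr rfl fun a _ => ?_
    rw [map_smul, LinearMap.smul_apply, smul_eq_mul, b.coord_apply]
  have hmem : α ∈ dualRelations 𝒜 := fun r hr => by
    rw [hα, LinearMap.comp_apply, LinearMap.mem_ker.1 hr, map_zero]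
  refine ⟨theta 𝒜 f ⟨α, hmem⟩, ?_⟩
  have hrel := RingQuot.mkAlgHom_rel ℂ (CliffordRel.of (θ := theta 𝒜 f) ⟨α, hmem⟩)
  rw [AlgHom.commutes] at hrel
  rw [← hrel, map_sum, map_sum]
  refine Finset.sum_congr rfl fun a _ => ?_
  exact (map_mul (RingQuot.mkAlgHom ℂ (CliffordRel (dualRelations 𝒜) (theta 𝒜 f)))
    (TensorAlgebra.ι ℂ _) (TensorAlgebra.ι ℂ _)).symm

end CliffordDimension

/-! ### The orbit map is bijective -/

section CliffordDimension

variable {A : Type u} [Ring A] [Algebra ℂ A] {𝒜 : ℕ → Submodule ℂ A}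
  {f : A} {J : Type u} [Fintype J] [DecidableEq J] {deg : J → ℕ} {D δ : J → J → 𝒜 1}

open Matrix

namespace IsLinearFactorization

variable (h : IsLinearFactorization 𝒜 f deg D δ) {j₀ : J}
include h

lemma orbit_sum_mul_cliffι {k : ℕ} {e : J → Cliff 𝒜 f}
    (he : ∀ l, deg l = k → h.orbit j₀ (e l) = Pi.single l 1)
    {φ : J → Module.Dual ℂ (𝒜 1)} (hφ : ∀ l, deg l ≠ k → φ l = 0) {j : J} (hj : k ≤ deg j) :
    h.orbit j₀ (∑ l, e l * cliffι 𝒜 f (φ l)) j = ∑ l, φ l (δ j l) := by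
  rw [map_sum, Finset.sum_apply]
  refine Finset.sum_congr rfl fun l _ => ?_
  by_cases hl : deg l = k
  · rw [orbit_mul_cliffι, he l hl, single_vecMul_evalMatrix, h.apply_eq_of_deg (by lia)]
  · rw [hφ l hl, map_zero, mul_zero, map_zero, Pi.zero_apply, LinearMap.zero_apply]

omit [Fintype J] h in
lemma single_mem_lowVectors {k : ℕ} {l : J} (hl : deg l < k) :
    (Pi.single l 1 : J → ℂ) ∈ lowVectors deg k := fun j hj => by
  rw [Pi.single_eq_of_ne]
  rintro rfl
  lia

/-- The generator of degree zero generates the module, compatibly with the filtrations. -/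
lemma exists_orbit_eq [GradedAlgebra 𝒜] [Nontrivial A] (hj₀ : ∀ j, deg j = 0 ↔ j = j₀) {k : ℕ}
    {v : J → ℂ} (hv : v ∈ lowVectors deg k) : ∃ c ∈ cliffFil 𝒜 f k, h.orbit j₀ c = v := by
  cases k with
  | zero => exact ⟨0, zero_mem _, by rw [map_zero]; ext l; exact (hv l (Nat.zero_le _)).symm⟩
  | succ k =>
    induction k generalizing v with
    | zero =>
      refine ⟨v j₀ • 1, ?_, ?_⟩
      · rw [cliffFil, pow_zero]
        exact Submodule.smul_mem _ _ (Submodule.one_le.1 le_rfl)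
      · rw [map_smul, orbit_one]
        ext l
        rw [Pi.smul_apply, smul_eq_mul]
        by_cases hl : l = j₀
        · rw [hl, Pi.single_eq_same, mul_one]
        · rw [Pi.single_eq_of_ne hl, mul_zero, hv l (by have := mt (hj₀ l).1 hl; lia)]
    | succ k ih =>
      have hex : ∀ l, ∃ c, deg l < k + 1 → c ∈ cliffFil 𝒜 f (k + 1) ∧
          h.orbit j₀ c = Pi.single l 1 := fun l => by
        by_cases hl : deg l < k + 1
        · obtain ⟨c, hc⟩ := ih (single_mem_lowVectors hl)
          exact ⟨c, fun _ => hc⟩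
        · exact ⟨0, fun hl' => absurd hl' hl⟩
      choose e he using hex
      obtain ⟨φ, hφ, hφu⟩ := h.exists_sum_apply_eq (k := k)
        (fun j => if deg j = k + 1 then v j else 0)
        (fun j hj => if_neg hj)
      have hsum : v - h.orbit j₀ (∑ l, e l * cliffι 𝒜 f (φ l)) ∈ lowVectors deg (k + 1) := by
        intro j hj
        rw [Pi.sub_apply, h.orbit_sum_mul_cliffι (fun l hl => (he l (by lia)).2) hφ (by lia), hφu]
        split_ifs with hjk
        · exact sub_self _
        · rw [hv j (by lia), sub_zero]
      obtain ⟨c, hc, hcv⟩ := ih hsum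
      refine ⟨∑ l, e l * cliffι 𝒜 f (φ l) + c, add_mem (Submodule.sum_mem _ fun l _ => ?_)
        (cliffFil_le_succ _ hc), by rw [map_add, hcv, add_sub_cancel]⟩
      by_cases hl : deg l = k
      · exact cliffFil_mul_cliffι (he l (by lia)).1 _
      · rw [hφ l hl, map_zero, mul_zero]
        exact zero_mem _

section Injective

variable {e : J → Cliff 𝒜 f} (hefil : ∀ l, e l ∈ cliffFil 𝒜 f (deg l + 1))
  (he : ∀ l, h.orbit j₀ (e l) = Pi.single l 1) {k : ℕ}
  (ih : ∀ c ∈ cliffFil 𝒜 f (k + 1), h.orbit j₀ c ∈ lowVectors deg k → c ∈ cliffFil 𝒜 f k)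
include hefil he ih

/-- An element of the filtration is determined, modulo lower terms, by the leading term of its
image under the orbit map. -/
lemma sub_sum_mem_cliffFil (hj₀ : deg j₀ = 0) {c : Cliff 𝒜 f} (hc : c ∈ cliffFil 𝒜 f (k + 1)) :
    c - ∑ l, (if deg l = k then h.orbit j₀ c l else 0) • e l ∈ cliffFil 𝒜 f k := by
  refine ih _ (sub_mem hc (Submodule.sum_mem _ fun l _ => ?_)) fun j hj => ?_
  · split_ifs with hl
    · exact Submodule.smul_mem _ _ (hl ▸ hefil l)
    · rw [zero_smul]
      exact zero_mem _
  · rw [map_sub, map_sum, Pi.sub_apply, Finset.sum_apply, Finset.sum_eq_single j]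
    · rw [map_smul, he, Pi.smul_apply, Pi.single_eq_same, smul_eq_mul, mul_one]
      split_ifs with hjk
      · exact sub_self _
      · rw [sub_zero]
        exact h.orbit_mem_lowVectors hj₀ hc j (by lia)
    · intro l _ hlj
      rw [map_smul, he, Pi.smul_apply, Pi.single_eq_of_ne hlj.symm, smul_zero]
    · exact fun hn => absurd (Finset.mem_univ j) hn

/-- Modulo lower terms, the elements of the next step of the filtration are combinations of the
products of the chosen generators of degree `k` with elements of degree one. -/
lemma exists_sub_sum_mul_cliffι_mem (hj₀ : deg j₀ = 0) {c : Cliff 𝒜 f}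
    (hc : c ∈ cliffFil 𝒜 f (k + 2)) : ∃ w : J → Module.Dual ℂ (𝒜 1),
      (∀ l, deg l ≠ k → w l = 0) ∧
      c - ∑ l, e l * cliffι 𝒜 f (w l) ∈ cliffFil 𝒜 f (k + 1) := by
  rw [cliffFil_succ_succ] at hc
  obtain ⟨c', hc', c, hprod, rfl⟩ := Submodule.mem_sup.1 hc
  suffices ∃ w : J → Module.Dual ℂ (𝒜 1), (∀ l, deg l ≠ k → w l = 0) ∧
      c - ∑ l, e l * cliffι 𝒜 f (w l) ∈ cliffFil 𝒜 f (k + 1) by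
    obtain ⟨w, hw, hwc⟩ := this
    refine ⟨w, hw, ?_⟩
    rw [add_sub_assoc]
    exact add_mem hc' hwc
  clear hc
  induction hprod using Submodule.mul_induction_on' with
  | mem_mul_mem a ha _ hξ =>
    obtain ⟨ξ, rfl⟩ := hξ
    refine ⟨fun l => (if deg l = k then h.orbit j₀ a l else 0) • ξ, fun l hl => ?_, ?_⟩
    · beta_reduce
      rw [if_neg hl, zero_smul]
    · have := cliffFil_mul_cliffι (h.sub_sum_mem_cliffFil hefil he ih hj₀ ha) ξ
      rw [sub_mul, Finset.sum_mul] at this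
      refine (congrArg (· ∈ cliffFil 𝒜 f (k + 1)) ?_).mp this
      congr 1
      exact Finset.sum_congr rfl fun l _ => by rw [map_smul, smul_mul_assoc, mul_smul_comm]
  | add a _ b _ ha hb =>
    obtain ⟨w, hw, hwa⟩ := ha
    obtain ⟨w', hw', hwb⟩ := hb
    refine ⟨w + w', fun l hl => by rw [Pi.add_apply, hw l hl, hw' l hl, add_zero], ?_⟩
    simp_rw [Pi.add_apply, map_add, mul_add, Finset.sum_add_distrib]
    rw [add_sub_add_comm]
    exact add_mem hwa hwb

/-- The quadratic relations of the Clifford deformation suffice to rewrite a product that comes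
from a functional on `A_2` in lower terms. -/
lemma sum_mul_dualMulLeft_mem (hj₀ : deg j₀ = 0) [Module.Finite ℂ (𝒜 1)] {i : J}
    (hi : deg i + 1 = k) (ψ : Module.Dual ℂ A) :
    ∑ l, e l * cliffι 𝒜 f (dualMulLeft ψ (δ l i)) ∈ cliffFil 𝒜 f (k + 1) := by
  let b := Module.finBasis ℂ (𝒜 1)
  have hR : ∀ a, e i * cliffι 𝒜 f (b.coord a) - ∑ l, b.coord a (δ l i) • e l ∈
      cliffFil 𝒜 f k := by
    intro a
    have hmem : e i * cliffι 𝒜 f (b.coord a) ∈ cliffFil 𝒜 f (k + 1) :=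
      cliffFil_mul_cliffι (hi ▸ hefil i) _
    have := h.sub_sum_mem_cliffFil hefil he ih hj₀ hmem
    convert this using 4 with l
    rw [orbit_mul_cliffι, he, single_vecMul_evalMatrix]
    split_ifs with hl
    · rw [h.apply_eq_of_deg (by lia)]
    · have : δ l i = 0 := by
        by_contra h0
        have := h.deg_eq h0
        lia
      rw [this, map_zero]
  obtain ⟨r, hr⟩ := exists_sum_cliffι_mul_cliffι f b ψ
  have hsum : ∑ l, e l * cliffι 𝒜 f (dualMulLeft ψ (δ l i)) = r • e i -
      ∑ a, (e i * cliffι 𝒜 f (b.coord a) - ∑ l, b.coord a (δ l i) • e l) *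
        cliffι 𝒜 f (dualMulLeft ψ (b a)) := by
    have h1 : ∀ l, cliffι 𝒜 f (dualMulLeft ψ (δ l i)) =
        ∑ a, b.coord a (δ l i) • cliffι 𝒜 f (dualMulLeft ψ (b a)) := by
      intro l
      conv_lhs => rw [← b.sum_repr (δ l i)]
      simp_rw [map_sum, map_smul, b.coord_apply]
    have h2 : r • e i = ∑ a, e i * cliffι 𝒜 f (b.coord a) * cliffι 𝒜 f (dualMulLeft ψ (b a)) := by
      simp_rw [mul_assoc]
      rw [← Finset.mul_sum, hr, ← Algebra.commutes, Algebra.smul_def]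
    rw [h2, ← Finset.sum_sub_distrib]
    simp_rw [h1, Finset.mul_sum]
    rw [Finset.sum_comm]
    refine Finset.sum_congr rfl fun a _ => ?_
    rw [sub_mul, sub_sub_cancel, Finset.sum_mul]
    exact Finset.sum_congr rfl fun l _ => by rw [mul_smul_comm, smul_mul_assoc]
  rw [hsum]
  exact sub_mem (cliffFil_le_succ _ (hi ▸ Submodule.smul_mem _ _ (hefil i)))
    (Submodule.sum_mem _ fun a _ => cliffFil_mul_cliffι (hR a) _)

end Injective

/-- The orbit map is strictly compatible with the filtrations. -/
lemma mem_cliffFil_of_orbit_mem [GradedAlgebra 𝒜] (hconn : IsConnectedGraded 𝒜)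
    [Module.Finite ℂ (𝒜 1)] (hj₀ : ∀ j, deg j = 0 ↔ j = j₀) {k : ℕ} {c : Cliff 𝒜 f}
    (hc : c ∈ cliffFil 𝒜 f (k + 1)) (hck : h.orbit j₀ c ∈ lowVectors deg k) :
    c ∈ cliffFil 𝒜 f k := by
  have := hconn.1
  have h0 : deg j₀ = 0 := (hj₀ j₀).2 rfl
  choose e hefil he using fun l =>
    h.exists_orbit_eq hj₀ (single_mem_lowVectors (Nat.lt_succ_self (deg l)))
  induction k generalizing c with
  | zero =>
    rw [cliffFil, pow_zero] at hc
    obtain ⟨r, rfl⟩ := Submodule.mem_one.1 hc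
    rw [Algebra.algebraMap_eq_smul_one, map_smul, orbit_one] at hck
    have hr := hck j₀ (Nat.zero_le _)
    rw [Pi.smul_apply, Pi.single_eq_same, smul_eq_mul, mul_one] at hr
    rw [hr, map_zero]
    exact zero_mem _
  | succ k ih =>
    have ih' : ∀ c ∈ cliffFil 𝒜 f (k + 1), h.orbit j₀ c ∈ lowVectors deg k →
        c ∈ cliffFil 𝒜 f k := fun c hc hck => ih hc hck
    obtain ⟨w, hw, hwc⟩ := h.exists_sub_sum_mul_cliffι_mem hefil he ih' h0 hc
    have horb := sub_mem hck (h.orbit_mem_lowVectors h0 hwc)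
    rw [← map_sub, sub_sub_cancel] at horb
    have hrel : ∀ j, ∑ l, w l (δ j l) = 0 := by
      intro j
      by_cases hj : k + 1 ≤ deg j
      · rw [← h.orbit_sum_mul_cliffι (fun l _ => he l) hw (by lia)]
        exact horb j hj
      · refine Finset.sum_eq_zero fun l _ => ?_
        by_cases hl : deg l = k
        · have : δ j l = 0 := by
            by_contra h0
            have := h.deg_eq h0
            lia
          rw [this, map_zero]
        · rw [hw l hl, LinearMap.zero_apply]
    obtain ⟨ψ, hψ, hψw⟩ := h.exists_dualMulLeft_eq hconn w hw hrel
    have hmem : ∑ l, e l * cliffι 𝒜 f (w l) ∈ cliffFil 𝒜 f (k + 1) := by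
      simp_rw [← hψw, map_sum, Finset.mul_sum]
      rw [Finset.sum_comm]
      refine Submodule.sum_mem _ fun i _ => ?_
      by_cases hi : deg i + 1 = k
      · exact h.sum_mul_dualMulLeft_mem hefil he ih' h0 hi (ψ i)
      · refine Submodule.sum_mem _ fun l _ => ?_
        have : dualMulLeft (ψ i) (δ l i) = 0 := by
          ext x
          rw [dualMulLeft_apply, hψ i hi, LinearMap.zero_apply, LinearMap.zero_apply]
        rw [this, map_zero, mul_zero]
        exact zero_mem _
    exact (sub_add_cancel c _) ▸ add_mem hwc hmem

/-- The orbit map identifies the Clifford deformation with the vector space on the generators of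
the resolution. -/
theorem orbit_bijective [GradedAlgebra 𝒜] (hconn : IsConnectedGraded 𝒜)
    [Module.Finite ℂ (𝒜 1)] (hj₀ : ∀ j, deg j = 0 ↔ j = j₀) :
    Function.Bijective (h.orbit j₀) := by
  have := hconn.1
  constructor
  · rw [injective_iff_map_eq_zero]
    intro c hc
    obtain ⟨k, hk⟩ := exists_mem_cliffFil c
    have key : ∀ m, m ≤ k + 1 → c ∈ cliffFil 𝒜 f (k + 1 - m) := by
      intro m
      induction m with
      | zero => exact fun _ => hk
      | succ m ih =>
        intro hm
        have h1 := ih (by lia)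
        rw [show k + 1 - m = k + 1 - (m + 1) + 1 by lia] at h1
        exact h.mem_cliffFil_of_orbit_mem hconn hj₀ h1 (hc ▸ zero_mem _)
    have := key (k + 1) le_rfl
    rw [Nat.sub_self] at this
    exact (Submodule.mem_bot ℂ).1 this
  · intro v
    obtain ⟨c, -, hc⟩ := h.exists_orbit_eq hj₀ (k := Finset.univ.sup deg + 1) (v := v)
      fun l hl => by
        have : deg l ≤ Finset.univ.sup deg := Finset.le_sup (Finset.mem_univ l)
        lia
    exact ⟨c, hc⟩

end IsLinearFactorization

end CliffordDimension

/-! ### The dimension of the Clifford deformation -/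

section Main

variable {A : Type u} [Ring A] [Algebra ℂ A] {𝒜 : ℕ → Submodule ℂ A}

open Matrix

lemma IsConnectedGraded.op (h : IsConnectedGraded 𝒜) : IsConnectedGraded (opGrading 𝒜) := by
  have := h.1
  refine ⟨inferInstance, ?_⟩
  ext x
  rw [mem_opGrading, h.2, Submodule.mem_one, Submodule.mem_one]
  exact exists_congr fun c => ⟨fun hc => MulOpposite.unop_injective hc, fun hc => by rw [← hc]; rfl⟩

lemma IsLocallyFinite.op (h : IsLocallyFinite 𝒜) : IsLocallyFinite (opGrading 𝒜) := fun i =>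
  have := h i
  Module.Finite.equiv (opGradingEquiv 𝒜 i)

/-- `A` as a right module over itself is the regular left module of the opposite ring. -/
lemma injectiveDimension_op (A : Type u) [Ring A] :
    injectiveDimension (ModuleCat.of Aᵐᵒᵖ Aᵐᵒᵖ) = injectiveDimension (ModuleCat.of Aᵐᵒᵖ A) := by
  let e : A ≃ₗ[Aᵐᵒᵖ] Aᵐᵒᵖ :=
    { MulOpposite.opAddEquiv with map_smul' := fun _ _ => rfl }
  exact injectiveDimension_eq_of_iso e.symm.toModuleIso

/-- The length `m` of the minimal resolution of the trivial module is the injective dimension: its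
graded dual has cohomology in degree `m`, and by the Gorenstein condition only in degree `d`. -/
lemma IsASGorenstein.eq_of_card_eq_choose [GradedAlgebra 𝒜] {d m : ℕ} (hA : IsASGorenstein 𝒜 d)
    (hlf : IsLocallyFinite 𝒜) {P : GradedFreeResolution (opGrading 𝒜)} (hP : P.IsLinear)
    (hcard : ∀ k, Nat.card (P.ι k) = m.choose k) : d = m := by
  have hconn := hA.connected.op
  have hfin := hP.finite hconn hlf.op
  by_contra hdm
  have : Nonempty (P.ι m) := by
    rw [← Finite.card_pos_iff, hcard, Nat.choose_self]
    exact one_pos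
  have : IsEmpty (P.ι (m + 1)) := by
    rw [← Finite.card_eq_zero_iff, hcard, Nat.choose_succ_self]
  exact hP.not_subsingleton_gradedExt hconn ((hA.ext_right P).1 m (Ne.symm hdm))

lemma card_sigma_of_card_eq_choose {ι : ℕ → Type u} [∀ k, Finite (ι k)] {m : ℕ}
    (hcard : ∀ k, Nat.card (ι k) = m.choose k) :
    Finite (Σ k, ι k) ∧ Nat.card (Σ k, ι k) = 2 ^ m := by
  have hlt : ∀ x : Σ k, ι k, x.1 < m + 1 := fun x => by
    by_contra hx
    have h0 := hcard x.1
    rw [Nat.choose_eq_zero_of_lt (by lia), Finite.card_eq_zero_iff] at h0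
    exact h0.elim x.2
  let e : (Σ k : Fin (m + 1), ι k) ≃ Σ k, ι k :=
    { toFun x := ⟨x.1, x.2⟩
      invFun x := ⟨⟨x.1, hlt x⟩, x.2⟩
      left_inv _ := rfl
      right_inv _ := rfl }
  refine ⟨Finite.of_equiv _ e, ?_⟩
  rw [← Nat.card_congr e, Nat.card_sigma]
  simp_rw [hcard]
  rw [Fin.sum_univ_eq_sum_range (fun k => m.choose k), Nat.sum_range_choose]

/-- The Clifford deformation of a linearly resolved algebra has the dimension of the total Betti
number of the trivial module. -/
theorem finrank_cliff_of_linear [GradedAlgebra 𝒜] (hconn : IsConnectedGraded 𝒜)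
    (hlf : IsLocallyFinite 𝒜) {P : GradedFreeResolution (opGrading 𝒜)} (hP : P.IsLinear)
    [Finite (Σ k, P.ι k)] {f : A} (hf : f ∈ 𝒜 2) (hcentral : f ∈ Subalgebra.center ℂ A) :
    Module.Finite ℂ (Cliff 𝒜 f) ∧ Module.finrank ℂ (Cliff 𝒜 f) = Nat.card (Σ k, P.ι k) := by
  classical
  have := hP.finite hconn.op hlf.op
  have := Fintype.ofFinite (Σ k, P.ι k)
  have := hlf 1
  have hδ := hP.isLinearResolutionMatrix hconn.op
  obtain ⟨D, hD, hDδ, hDD⟩ := hδ.exists_factorization (f := MulOpposite.op f)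
    ((mem_opGrading 𝒜).2 hf) fun x => MulOpposite.unop_injective
      ((Subalgebra.mem_center_iff.1 hcentral x.unop))
  obtain ⟨j₀, hj₀, hj₀'⟩ := hδ.existsUnique
  have h : IsLinearFactorization 𝒜 f Sigma.fst
      (fun j i => ⟨(D j i).unop, (mem_opGrading 𝒜).1 (hD j i)⟩)
      (fun j i => ⟨(P.totalMatrix j i).unop, (mem_opGrading 𝒜).1 (hδ.entry_mem j i)⟩) :=
    { resolution := hδ
      deg_lt := fun j i hji => by
        have := hDδ j i fun h0 => hji (Subtype.ext (congrArg MulOpposite.unop (sub_eq_zero.1 h0)))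
        lia
      sq := fun j i => by
        have h1 := congrArg MulOpposite.unop (congrFun (congrFun hDD j) i)
        rw [Matrix.mul_apply, Finset.unop_sum, Matrix.scalar_apply, Matrix.diagonal_apply] at h1
        refine Eq.trans h1 ?_
        split_ifs <;> rfl }
  have hbij := h.orbit_bijective (j₀ := j₀) hconn fun j => ⟨hj₀' j, fun hj => hj ▸ hj₀⟩
  let e := LinearEquiv.ofBijective _ hbij
  refine ⟨Module.Finite.equiv e.symm, ?_⟩
  rw [e.finrank_eq, Module.finrank_fintype_fun_eq_card, Nat.card_eq_fintype_card]

lemma even_of_mul_self_eq_two_pow {r n : ℕ} (h : r * r = 2 ^ n) : Even n := by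
  obtain ⟨a, -, rfl⟩ := (Nat.dvd_prime_pow Nat.prime_two).1 (Dvd.intro r h)
  rw [← pow_add] at h
  exact ⟨a, (Nat.pow_right_injective le_rfl h).symm⟩

lemma odd_of_mul_self_mul_two_eq_two_pow {r n : ℕ} (h : r * r * 2 = 2 ^ n) : Odd n := by
  cases n with
  | zero => lia
  | succ n =>
    rw [pow_succ] at h
    exact (even_of_mul_self_eq_two_pow (Nat.eq_of_mul_eq_mul_right two_pos h)).add_one

lemma finrank_groupAlgebraTwo : Module.finrank ℂ GroupAlgebraTwo = 2 := by
  let e : GroupAlgebraTwo ≃ₗ[ℂ] (ZMod 2 →₀ ℂ) :=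
    { AddMonoidAlgebra.coeffAddEquiv with map_smul' := fun _ _ => rfl }
  rw [e.finrank_eq, Module.finrank_finsupp_self, ZMod.card]

end Main

end QuadricHypersurface

end

open QuadricHypersurface in
theorem mainTheorem10 {A : Type u} [Ring A] [Algebra ℂ A] (𝒜 : ℕ → Submodule ℂ A)
    [GradedAlgebra 𝒜] (n : ℕ)
    (hA : QuadricHypersurface.IsQuantumPolynomialAlgebra 𝒜)
    (hn : QuadricHypersurface.globalDimension Aᵐᵒᵖ = n)
    (f : A) (hf : f ∈ 𝒜 2) (hcentral : f ∈ Subalgebra.center ℂ A) (hregular : IsRegular f) :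
    (Module.Finite ℂ (QuadricHypersurface.Cliff 𝒜 f) ∧
      Module.finrank ℂ (QuadricHypersurface.Cliff 𝒜 f) = 2 ^ n) ∧
    (QuadricHypersurface.IsZeroType 𝒜 f → Even n) ∧
    (QuadricHypersurface.IsOneType 𝒜 f → Odd n) := by
  obtain ⟨hconn, hlf, P, hP⟩ := hA.koszul
  obtain ⟨⟨d, hd⟩, -⟩ := hA.regular
  obtain ⟨m, -, hm⟩ := hA.hilbert
  have := hA.noetherian_right
  have hm' : PowerSeries.mk (fun i => (Module.finrank ℂ (opGrading 𝒜 i) : ℤ)) *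
      (1 - PowerSeries.X) ^ m = 1 := by
    simp_rw [← (opGradingEquiv 𝒜 _).finrank_eq]
    exact hm
  have hcard := hP.card_eq_choose hconn.op hlf.op hm'
  have hdm := hd.eq_of_card_eq_choose hlf hP hcard
  have hnd := eq_injectiveDimension_of_globalDimension_eq hn
    ((injectiveDimension_op A).trans hd.injdim_right)
  have := hP.finite hconn.op hlf.op
  obtain ⟨_, hJ⟩ := card_sigma_of_card_eq_choose hcard
  have hC := finrank_cliff_of_linear hconn hlf hP hf hcentral
  rw [hJ, ← hdm, ← hnd] at hC
  refine ⟨hC, ?_, ?_⟩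
  · rintro ⟨-, r, s, e, -⟩
    have h := e.toLinearEquiv.finrank_eq
    rw [hC.2, Module.finrank_matrix, Module.finrank_self, mul_one, Fintype.card_fin] at h
    exact even_of_mul_self_eq_two_pow h.symm
  · rintro ⟨-, r, s, e, -⟩
    have h := e.toLinearEquiv.finrank_eq
    rw [hC.2, Module.finrank_matrix, finrank_groupAlgebraTwo, Fintype.card_fin] at h
    exact odd_of_mul_self_mul_two_eq_two_pow h.symm
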